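/- Conventions. Let $n\ge 2$ be a natural number, $A_n=\{a_1,\dots,a_n\}$ an alphabet with $n$ letters and $A_n^*$ the free monoid on $A_n$, with empty string $\varepsilon$. A right ideal of $A_n^*$ is a set of the form $XA_n^*$; it is finitely generated if $X$ can be taken finite and principal if $X$ can be taken to be a singleton. A morphism between right ideals is a map $\alpha$ with $\alpha(rs)=\alpha(r)s$. Let $P_n$ be the inverse monoid (under composition of partial functions) of all bijective morphisms between principal right ideals of $A_n^*$ together with the empty function $0$; for strings $x,y$ the map $yu\mapsto xu$ is written $xy^{-1}$, and $a_i\in P_n$ denotes $a_i\varepsilon^{-1}$. Let $D_n\supseteq P_n$ be the inverse monoid of all bijective morphisms between finitely generated right ideals of $A_n^*$. All inverse monoids here have a zero, and homomorphisms preserve $0$ and $1$. On an inverse monoid the natural partial order is $a\le b\iff a=ba^{-1}a$, and $a,b$ are compatible if $a^{-1}b$ and $ab^{-1}$ are idempotents. An inverse monoid is distributive if each compatible pair has a join and multiplication (on either side) distributes over such joins; it is Boolean if moreover its idempotents form a Boolean algebra under the natural partial order. A morphism of Boolean inverse monoids is a homomorphism that maps joins of compatible pairs to joins. A finite set $\{b_1,\dots,b_m\}$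 of elements $b_j\le a$ is a cover of $a$ if for every $0<x\le a$ there is $j$ with $x\wedge b_j\ne 0$. A homomorphism $\theta\colon S\to B$ to a Boolean inverse monoid is cover-to-join if $\theta(a)=\bigvee_{j}\theta(b_j)$ whenever $\{b_1,\dots,b_m\}$ is a cover of $a$ in $S$. The Lenz congruence $\equiv$ on an inverse monoid is: $s\equiv t$ if and only if for every $0<x\le s$ there is a nonzero $z\le x,t$ and for every $0<y\le t$ there is a nonzero $z\le y,s$. Put $C_n=D_n/{\equiv}$, and let $\iota\colon P_n\to C_n$ be the composite of the inclusion $P_n\subseteq D_n$ with the quotient map. Theorem. Let $B$ be a Boolean inverse monoid and let $\theta\colon P_n\to B$ be a homomorphism of monoids with zero such that $\bigvee_{i=1}^n\theta(a_ia_i^{-1})=1$. Then: (1) $\theta$ is a cover-to-join map. (2) There is a unique morphism of Boolean inverse monoids $\psi\colon C_n\to B$ such that $\psi\iota=\theta$. Consequently $\iota\colon P_n\to C_n$ is the tight completion of $P_n$: $C_n$ is a Boolean inverse monoid, $\iota$ is a cover-to-join map, and for every cover-to-join homomorphism $\theta$ from $P_n$ to a Boolean inverse monoid $B$ there is a unique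 morphism of Boolean inverse monoids $\psi\colon C_n\to B$ with $\psi\iota=\theta$. -/

import Mathlib

/-- An inverse monoid with zero: each `a` has exactly one `b` with `a b a = a` and `b a b = b`,
and this `b` is `a⁻¹`. -/
class InverseMonoidWithZero (S : Type*) extends MonoidWithZero S, Inv S where
  mul_inv_mul : ∀ a : S, a * a⁻¹ * a = a
  inv_mul_inv : ∀ a : S, a⁻¹ * a * a⁻¹ = a⁻¹
  inv_unique : ∀ a b : S, a * b * a = a → b * a * b = b → b = a⁻¹

namespace InverseMonoidWithZero

section Theory

variable {S : Type*} [InverseMonoidWithZero S]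

theorem inv_inv' (a : S) : a⁻¹⁻¹ = a :=
  (inv_unique a⁻¹ a (inv_mul_inv a) (mul_inv_mul a)).symm

theorem idem_inv {e : S} (he : e * e = e) : e⁻¹ = e :=
  (inv_unique e e (by rw [he, he]) (by rw [he, he])).symm

theorem idem_mul_idem {e f : S} (he : e * e = e) (hf : f * f = f) :
    (e * f) * (e * f) = e * f := by
  have h1 := mul_inv_mul (e * f)
  have h2 := inv_mul_inv (e * f)
  set x := (e * f)⁻¹ with hx
  have key : f * x * e = x := by
    apply inv_unique
    · calc e * f * (f * x * e) * (e * f) = e * (f * f) * x * (e * e) * f := by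
            simp only [mul_assoc]
        _ = e * f * x * (e * f) := by rw [he, hf]; simp only [mul_assoc]
        _ = e * f := h1
    · calc f * x * e * (e * f) * (f * x * e) = f * (x * ((e * e) * (f * f)) * x) * e := by
            simp only [mul_assoc]
        _ = f * x * e := by rw [he, hf, h2]
  have hidem : x * x = x := by
    calc x * x = (f * x * e) * (f * x * e) := by rw [key]
      _ = f * (x * (e * f) * x) * e := by simp only [mul_assoc]
      _ = x := by rw [h2, key]
  have h3 : x⁻¹ = x := idem_inv hidem
  rw [hx, inv_inv'] at h3
  rw [h3, ← hx]
  exact hidem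

theorem idem_comm {e f : S} (he : e * e = e) (hf : f * f = f) : e * f = f * e := by
  have h1 := idem_mul_idem he hf
  have h2 := idem_mul_idem hf he
  have h3 : f * e = (e * f)⁻¹ := by
    apply inv_unique
    · calc e * f * (f * e) * (e * f) = e * (f * f) * (e * e) * f := by simp only [mul_assoc]
        _ = e * f * (e * f) := by rw [he, hf]; simp only [mul_assoc]
        _ = e * f := h1
    · calc f * e * (e * f) * (f * e) = f * (e * e) * (f * f) * e := by simp only [mul_assoc]
        _ = f * e * (f * e) := by rw [he, hf]; simp only [mul_assoc]
        _ = f * e := h2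
  rw [h3, idem_inv h1]

theorem inv_mul_idem (a : S) : (a⁻¹ * a) * (a⁻¹ * a) = a⁻¹ * a := by
  rw [← mul_assoc, inv_mul_inv]

theorem mul_inv_idem (a : S) : (a * a⁻¹) * (a * a⁻¹) = a * a⁻¹ := by
  rw [← mul_assoc, mul_inv_mul]

theorem mul_inv_rev' (a b : S) : (a * b)⁻¹ = b⁻¹ * a⁻¹ := by
  symm
  have hc := idem_comm (inv_mul_idem a) (mul_inv_idem b)
  apply inv_unique
  · calc a * b * (b⁻¹ * a⁻¹) * (a * b) = a * ((b * b⁻¹) * (a⁻¹ * a)) * b := by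
          simp only [mul_assoc]
      _ = (a * a⁻¹ * a) * (b * b⁻¹ * b) := by rw [← hc]; simp only [mul_assoc]
      _ = a * b := by rw [mul_inv_mul, mul_inv_mul]
  · calc b⁻¹ * a⁻¹ * (a * b) * (b⁻¹ * a⁻¹) = b⁻¹ * ((a⁻¹ * a) * (b * b⁻¹)) * a⁻¹ := by
          simp only [mul_assoc]
      _ = (b⁻¹ * b * b⁻¹) * (a⁻¹ * a * a⁻¹) := by rw [hc]; simp only [mul_assoc]
      _ = b⁻¹ * a⁻¹ := by rw [inv_mul_inv, inv_mul_inv]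

/-- The natural partial order: `a ≤ b` if and only if `a = b a⁻¹ a`. -/
instance : LE S := ⟨fun a b => a = b * a⁻¹ * a⟩

theorem le_def {a b : S} : a ≤ b ↔ a = b * a⁻¹ * a := Iff.rfl

theorem le_iff_right {a b : S} : a ≤ b ↔ ∃ e, e * e = e ∧ a = b * e := by
  constructor
  · intro h
    exact ⟨a⁻¹ * a, inv_mul_idem a, by rw [← mul_assoc]; exact h⟩
  · rintro ⟨e, he, rfl⟩
    rw [le_def, mul_inv_rev', idem_inv he]
    symm
    have hc := idem_comm he (inv_mul_idem b)
    calc b * (e * b⁻¹) * (b * e) = b * (e * (b⁻¹ * b)) * e := by simp only [mul_assoc]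
      _ = (b * b⁻¹ * b) * (e * e) := by rw [hc]; simp only [mul_assoc]
      _ = b * e := by rw [mul_inv_mul, he]

theorem le_iff_left {a b : S} : a ≤ b ↔ ∃ e, e * e = e ∧ a = e * b := by
  rw [le_iff_right]
  constructor
  · rintro ⟨e, he, rfl⟩
    have hc := idem_comm he (inv_mul_idem b)
    have h1 : b * e * b⁻¹ * b = b * e := by
      calc b * e * b⁻¹ * b = b * (e * (b⁻¹ * b)) := by simp only [mul_assoc]
        _ = (b * b⁻¹ * b) * e := by rw [hc]; simp only [mul_assoc]
        _ = b * e := by rw [mul_inv_mul]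
    refine ⟨b * e * b⁻¹, ?_, h1.symm⟩
    calc b * e * b⁻¹ * (b * e * b⁻¹) = (b * e * b⁻¹ * b) * e * b⁻¹ := by simp only [mul_assoc]
      _ = b * (e * e) * b⁻¹ := by rw [h1]; simp only [mul_assoc]
      _ = b * e * b⁻¹ := by rw [he]
  · rintro ⟨e, he, rfl⟩
    have hc := idem_comm he (mul_inv_idem b)
    have h1 : b * (b⁻¹ * e * b) = e * b := by
      calc b * (b⁻¹ * e * b) = ((b * b⁻¹) * e) * b := by simp only [mul_assoc]
        _ = e * (b * b⁻¹ * b) := by rw [← hc]; simp only [mul_assoc]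
        _ = e * b := by rw [mul_inv_mul]
    refine ⟨b⁻¹ * e * b, ?_, h1.symm⟩
    calc b⁻¹ * e * b * (b⁻¹ * e * b) = b⁻¹ * e * (b * (b⁻¹ * e * b)) := by simp only [mul_assoc]
      _ = b⁻¹ * (e * e) * b := by rw [h1]; simp only [mul_assoc]
      _ = b⁻¹ * e * b := by rw [he]

instance : PartialOrder S where
  le_refl a := le_iff_right.2 ⟨1, one_mul 1, (mul_one a).symm⟩
  le_trans a b c hab hbc := by
    obtain ⟨e, he, rfl⟩ := le_iff_right.1 hab
    obtain ⟨f, hf, rfl⟩ := le_iff_right.1 hbc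
    exact le_iff_right.2 ⟨f * e, idem_mul_idem hf he, by rw [mul_assoc]⟩
  le_antisymm a b hab hba := by
    obtain ⟨e, he, h1⟩ := le_iff_right.1 hab
    obtain ⟨f, hf, h2⟩ := le_iff_right.1 hba
    have h3 : a * e = a := by rw [h1, mul_assoc, he]
    have h4 : a = a * f := by
      calc a = b * e := h1
        _ = a * (f * e) := by rw [h2, mul_assoc]
        _ = a * (e * f) := by rw [idem_comm hf he]
        _ = a * f := by rw [← mul_assoc, h3]
    rw [h2, ← h4]

theorem zero_le' (a : S) : 0 ≤ a := le_iff_right.2 ⟨0, mul_zero 0, (mul_zero a).symm⟩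

theorem pos_iff {a : S} : 0 < a ↔ a ≠ 0 :=
  ⟨fun h => h.ne', fun h => lt_of_le_of_ne (zero_le' a) h.symm⟩

theorem mul_le_mul'' {a b c d : S} (h : a ≤ b) (h' : c ≤ d) : a * c ≤ b * d := by
  obtain ⟨e, he, rfl⟩ := le_iff_left.1 h
  obtain ⟨f, hf, rfl⟩ := le_iff_right.1 h'
  refine le_trans (b := b * d * f) (le_iff_left.2 ⟨e, he, by simp only [mul_assoc]⟩)
    (le_iff_right.2 ⟨f, hf, rfl⟩)

theorem inv_le_inv'' {a b : S} (h : a ≤ b) : a⁻¹ ≤ b⁻¹ := by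
  obtain ⟨e, he, rfl⟩ := le_iff_left.1 h
  exact le_iff_right.2 ⟨e, he, by rw [mul_inv_rev', idem_inv he]⟩

theorem inv_ne_zero' {a : S} (h : a ≠ 0) : a⁻¹ ≠ 0 := by
  intro h0
  apply h
  rw [← mul_inv_mul a, h0, mul_zero, zero_mul]

end Theory

/-- Inverse monoids with zero from the equational axioms. -/
@[reducible] def ofEquations (S : Type*) [MonoidWithZero S] [Inv S]
    (h1 : ∀ a : S, a⁻¹⁻¹ = a) (h2 : ∀ a b : S, (a * b)⁻¹ = b⁻¹ * a⁻¹)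
    (h3 : ∀ a : S, a * a⁻¹ * a = a)
    (h4 : ∀ a b : S, (a * a⁻¹) * (b * b⁻¹) = (b * b⁻¹) * (a * a⁻¹)) :
    InverseMonoidWithZero S where
  mul_inv_mul := h3
  inv_mul_inv a := by
    have := h3 a⁻¹
    rwa [h1] at this
  inv_unique a b hab hba := by
    have h3' : ∀ a : S, a⁻¹ * a * a⁻¹ = a⁻¹ := fun a => by
      have := h3 a⁻¹
      rwa [h1] at this
    have sa : ∀ e : S, e * e = e → e * e⁻¹ = e := by
      intro e he
      have hi : e⁻¹ * e⁻¹ = e⁻¹ := by rw [← h2, he]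
      have hc := h4 e⁻¹ e
      rw [h1] at hc
      have : e⁻¹ = e := by
        calc e⁻¹ = e⁻¹ * e * e⁻¹ := (h3' e).symm
          _ = e⁻¹ * e * (e * e⁻¹) := by
              rw [← mul_assoc, mul_assoc e⁻¹ e e, he]
          _ = e * e⁻¹ * (e⁻¹ * e) := hc
          _ = e * (e⁻¹ * e⁻¹) * e := by simp only [mul_assoc]
          _ = e := by rw [hi, h3]
      rw [this, he]
    have comm : ∀ e f : S, e * e = e → f * f = f → e * f = f * e := by
      intro e f he hf
      have := h4 e f
      rwa [sa e he, sa f hf] at this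
    have i1 : (a⁻¹ * a) * (a⁻¹ * a) = a⁻¹ * a := by rw [← mul_assoc, h3']
    have i2 : (a * a⁻¹) * (a * a⁻¹) = a * a⁻¹ := by rw [← mul_assoc, h3]
    have i3 : (b * a) * (b * a) = b * a := by rw [← mul_assoc, hba]
    have i4 : (a * b) * (a * b) = a * b := by rw [← mul_assoc, hab]
    have e1 : b = a⁻¹ * (a * b) := by
      calc b = b * a * b := hba.symm
        _ = b * (a * a⁻¹ * a) * b := by rw [h3]
        _ = (b * a) * (a⁻¹ * a) * b := by simp only [mul_assoc]
        _ = (a⁻¹ * a) * (b * a) * b := by rw [comm _ _ i3 i1]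
        _ = a⁻¹ * a * (b * a * b) := by simp only [mul_assoc]
        _ = a⁻¹ * (a * b) := by rw [hba, mul_assoc]
    have e2 : a⁻¹ = a⁻¹ * (a * b) := by
      calc a⁻¹ = a⁻¹ * a * a⁻¹ := (h3' a).symm
        _ = a⁻¹ * (a * b * a) * a⁻¹ := by rw [hab]
        _ = a⁻¹ * ((a * b) * (a * a⁻¹)) := by simp only [mul_assoc]
        _ = a⁻¹ * ((a * a⁻¹) * (a * b)) := by rw [comm _ _ i4 i2]
        _ = a⁻¹ * a * a⁻¹ * (a * b) := by simp only [mul_assoc]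
        _ = a⁻¹ * (a * b) := by rw [h3']
    rw [e1, ← e2]

section Notions

variable {S T : Type*} [InverseMonoidWithZero S] [InverseMonoidWithZero T]

/-- The compatibility relation: `a⁻¹ b` and `a b⁻¹` are idempotents. -/
def Compatible (a b : S) : Prop := IsIdempotentElem (a⁻¹ * b) ∧ IsIdempotentElem (a * b⁻¹)

variable (S) in
/-- Compatible pairs have joins, and multiplication distributes over these joins. -/
def IsDistributive : Prop :=
  (∀ a b : S, Compatible a b → ∃ j, IsLUB {a, b} j) ∧
  ∀ a b j c : S, Compatible a b → IsLUB {a, b} j →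
    IsLUB {c * a, c * b} (c * j) ∧ IsLUB {a * c, b * c} (j * c)

variable (S) in
/-- A distributive inverse monoid (with zero) whose idempotents form a Boolean algebra under the
natural partial order. -/
def IsBoolean : Prop :=
  IsDistributive S ∧
  ∃ b : BooleanAlgebra {e : S // IsIdempotentElem e}, ∀ e f, b.le e f ↔ (e : S) ≤ (f : S)

/-- A morphism of distributive (in particular, of Boolean) inverse monoids: a homomorphism of
monoids with zero that maps joins of compatible pairs to joins. -/
def IsJoinMorphism (ψ : S →*₀ T) : Prop :=
  ∀ a b j : S, Compatible a b → IsLUB {a, b} j → IsLUB {ψ a, ψ b} (ψ j)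

/-- `X` is a (tight) cover of `a`: a finite subset of `a^↓` such that each nonzero `x ≤ a` has a
nonzero meet with some element of `X`. -/
def IsTightCover (X : Set S) (a : S) : Prop :=
  X.Finite ∧ (∀ b ∈ X, b ≤ a) ∧
    ∀ x : S, 0 < x → x ≤ a → ∃ b ∈ X, ∃ m, IsGLB {x, b} m ∧ m ≠ 0

/-- `θ` maps covers to joins. -/
def IsCoverToJoin (θ : S →*₀ T) : Prop :=
  ∀ (a : S) (X : Set S), IsTightCover X a → IsLUB (θ '' X) (θ a)

/-- `ι : S → T` is a tight completion of `S`: `T` is a Boolean inverse monoid, `ι` is a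
cover-to-join map, and `ι` is universal among the cover-to-join maps from `S` to Boolean
inverse monoids. -/
def IsTightCompletion.{u, v, w} {S : Type v} {T : Type w} [InverseMonoidWithZero S]
    [InverseMonoidWithZero T] (ι : S →*₀ T) : Prop :=
  IsBoolean T ∧ IsCoverToJoin ι ∧
  ∀ (B : Type u) [InverseMonoidWithZero B], IsBoolean B →
    ∀ θ : S →*₀ B, IsCoverToJoin θ →
      ∃! ψ : T →*₀ B, IsJoinMorphism ψ ∧ ∀ s, ψ (ι s) = θ s

/-- One half of the Lenz relation. -/
def LenzLE (s t : S) : Prop := ∀ x : S, 0 < x → x ≤ s → ∃ z : S, z ≠ 0 ∧ z ≤ x ∧ z ≤ t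

theorem LenzLE.refl (s : S) : LenzLE s s := fun x hx hxs => ⟨x, pos_iff.1 hx, le_rfl, hxs⟩

theorem LenzLE.trans {s t u : S} (h : LenzLE s t) (h' : LenzLE t u) : LenzLE s u := by
  intro x hx hxs
  obtain ⟨z, hz, hzx, hzt⟩ := h x hx hxs
  obtain ⟨w, hw, hwz, hwu⟩ := h' z (pos_iff.2 hz) hzt
  exact ⟨w, hw, hwz.trans hzx, hwu⟩

theorem LenzLE.inv {s t : S} (h : LenzLE s t) : LenzLE s⁻¹ t⁻¹ := by
  intro x hx hxs
  have h1 := inv_le_inv'' hxs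
  rw [inv_inv'] at h1
  obtain ⟨z, hz, hzx, hzt⟩ := h x⁻¹ (pos_iff.2 (inv_ne_zero' (pos_iff.1 hx))) h1
  refine ⟨z⁻¹, inv_ne_zero' hz, ?_, inv_le_inv'' hzt⟩
  have h2 := inv_le_inv'' hzx
  rwa [inv_inv'] at h2

theorem LenzLE.mul_right {s t : S} (h : LenzLE s t) (u : S) : LenzLE (s * u) (t * u) := by
  intro x hx hxs
  have hx0 := pos_iff.1 hx
  obtain ⟨e, he, hxe⟩ := le_iff_left.1 hxs
  have hxu : x * u⁻¹ * u = x := by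
    rw [hxe]
    calc e * (s * u) * u⁻¹ * u = e * (s * (u * u⁻¹ * u)) := by simp only [mul_assoc]
      _ = e * (s * u) := by rw [mul_inv_mul]
  have hy0 : x * u⁻¹ ≠ 0 := fun h0 => hx0 (by rw [← hxu, h0, zero_mul])
  have hys : x * u⁻¹ ≤ s := by
    refine le_trans (b := s * (u * u⁻¹)) (le_iff_left.2 ⟨e, he, ?_⟩)
      (le_iff_right.2 ⟨_, mul_inv_idem u, rfl⟩)
    rw [hxe]; simp only [mul_assoc]
  obtain ⟨z, hz, hzx, hzt⟩ := h _ (pos_iff.2 hy0) hys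
  refine ⟨z * u, ?_, ?_, mul_le_mul'' hzt le_rfl⟩
  · intro h0
    obtain ⟨f, hf, hzf⟩ := le_iff_left.1 hzx
    have : z * (u * u⁻¹) = z := by
      rw [hzf]
      calc f * (x * u⁻¹) * (u * u⁻¹) = f * (x * (u⁻¹ * u * u⁻¹)) := by simp only [mul_assoc]
        _ = f * (x * u⁻¹) := by rw [inv_mul_inv]
    apply hz
    rw [← this, ← mul_assoc, h0, zero_mul]
  · have := mul_le_mul'' hzx (le_refl u)
    rwa [hxu] at this

theorem LenzLE.mul_left {s t : S} (h : LenzLE s t) (u : S) : LenzLE (u * s) (u * t) := by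
  have := (h.inv.mul_right u⁻¹).inv
  simpa only [mul_inv_rev', inv_inv'] using this

variable (S) in
/-- The Lenz congruence: `s ≡ t` if and only if for each `0 < x ≤ s` we have
`x^↓ ∩ t^↓ ≠ {0}`, and for each `0 < y ≤ t` we have `y^↓ ∩ s^↓ ≠ {0}`. -/
def lenzCon : Con S where
  r s t := LenzLE s t ∧ LenzLE t s
  iseqv :=
    { refl := fun s => ⟨LenzLE.refl s, LenzLE.refl s⟩
      symm := fun h => ⟨h.2, h.1⟩
      trans := fun h h' => ⟨h.1.trans h'.1, h'.2.trans h.2⟩ }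
  mul' := fun h h' =>
    ⟨(h.1.mul_right _).trans (h'.1.mul_left _), (h'.2.mul_left _).trans (h.2.mul_right _)⟩

variable (S) in
/-- The quotient of `S` by the Lenz congruence. -/
def LenzQuotient : Type _ := (lenzCon S).Quotient

/-- The congruence class of an element. -/
def lenzMk (s : S) : LenzQuotient S := ((s : (lenzCon S).Quotient))

instance : MonoidWithZero (LenzQuotient S) :=
  { (inferInstance : Monoid (lenzCon S).Quotient) with
    zero := lenzMk 0
    zero_mul := by
      rintro ⟨a⟩
      exact congrArg lenzMk (zero_mul a)
    mul_zero := by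
      rintro ⟨a⟩
      exact congrArg lenzMk (mul_zero a) }

instance : Inv (LenzQuotient S) :=
  ⟨Quotient.map' (fun a : S => a⁻¹) (fun _ _ h => ⟨h.1.inv, h.2.inv⟩)⟩

instance : InverseMonoidWithZero (LenzQuotient S) :=
  ofEquations (LenzQuotient S)
    (by rintro ⟨a⟩; exact congrArg lenzMk (inv_inv' a))
    (by rintro ⟨a⟩ ⟨b⟩; exact congrArg lenzMk (mul_inv_rev' a b))
    (by rintro ⟨a⟩; exact congrArg lenzMk (mul_inv_mul a))
    (by
      rintro ⟨a⟩ ⟨b⟩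
      exact congrArg lenzMk (idem_comm (mul_inv_idem a) (mul_inv_idem b)))

variable (S) in
/-- The natural map onto the quotient by the Lenz congruence. -/
def lenzHom : S →*₀ LenzQuotient S where
  toFun := lenzMk
  map_zero' := rfl
  map_one' := rfl
  map_mul' _ _ := rfl

end Notions

/-- A set of partial bijections of `α` that contains the identity and the empty map and is closed
under composition and inversion is an inverse monoid with zero. The product `f * g` is the
composite "first `g`, then `f`". -/
@[reducible] def ofPartialBijections {α : Type*} (p : (α ≃. α) → Prop)
    (h1 : p (PEquiv.refl α)) (h0 : p ⊥) (hinv : ∀ f, p f → p f.symm)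
    (hmul : ∀ f g, p f → p g → p (g.trans f)) : InverseMonoidWithZero {f : α ≃. α // p f} :=
  letI : MonoidWithZero {f : α ≃. α // p f} :=
    { mul := fun f g => ⟨g.1.trans f.1, hmul _ _ f.2 g.2⟩
      one := ⟨PEquiv.refl α, h1⟩
      zero := ⟨⊥, h0⟩
      mul_assoc := fun f g h => Subtype.ext (PEquiv.trans_assoc h.1 g.1 f.1).symm
      one_mul := fun f => Subtype.ext (PEquiv.trans_refl f.1)
      mul_one := fun f => Subtype.ext (PEquiv.refl_trans f.1)
      zero_mul := fun f => Subtype.ext (PEquiv.trans_bot f.1)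
      mul_zero := fun f => Subtype.ext (PEquiv.bot_trans f.1) }
  letI : Inv {f : α ≃. α // p f} := ⟨fun f => ⟨f.1.symm, hinv _ f.2⟩⟩
  ofEquations _
    (fun _ => rfl)
    (fun f g => Subtype.ext (PEquiv.symm_trans_rev g.1 f.1))
    (fun f => Subtype.ext (by
      change f.1.trans (f.1.symm.trans f.1) = f.1
      refine PEquiv.ext fun x => Option.ext fun y => ?_
      rw [← Option.mem_def, ← Option.mem_def]
      simp only [PEquiv.mem_trans, PEquiv.mem_iff_mem]
      constructor
      · rintro ⟨b, hb, c, hc, hy⟩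
        rwa [PEquiv.inj f.1 hb hc]
      · intro hy
        exact ⟨y, hy, x, hy, hy⟩))
    (fun f g => Subtype.ext (by
      change (g.1.symm.trans g.1).trans (f.1.symm.trans f.1)
        = (f.1.symm.trans f.1).trans (g.1.symm.trans g.1)
      classical
      rw [PEquiv.symm_trans_self, PEquiv.symm_trans_self]
      refine PEquiv.ext fun x => Option.ext fun y => ?_
      rw [← Option.mem_def, ← Option.mem_def]
      simp only [PEquiv.mem_trans, PEquiv.mem_ofSet_iff]
      constructor
      · rintro ⟨b, ⟨rfl, hb⟩, rfl, hx⟩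
        exact ⟨_, ⟨rfl, hx⟩, rfl, hb⟩
      · rintro ⟨b, ⟨rfl, hb⟩, rfl, hx⟩
        exact ⟨_, ⟨rfl, hx⟩, rfl, hb⟩))

end InverseMonoidWithZero

namespace PolycyclicCuntz

open InverseMonoidWithZero

/-- Strings over the alphabet `Fin n`; under concatenation `++` they form the free monoid. -/
abbrev Str (n : ℕ) : Type := List (Fin n)

variable {n : ℕ}

/-- The right ideal of the free monoid generated by `X`. -/
def rightIdeal (X : Set (Str n)) : Set (Str n) := {z | ∃ x ∈ X, ∃ u, z = x ++ u}

/-- The domain of definition of a partial bijection. -/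
def domain (f : Str n ≃. Str n) : Set (Str n) := {x | ∃ y, y ∈ f x}

/-- `f` is a morphism: where `f r` is defined, so is `f (r s)`, and `f (r s) = (f r) s`. -/
def IsMorphism (f : Str n ≃. Str n) : Prop := ∀ r t s : Str n, t ∈ f r → t ++ s ∈ f (r ++ s)

/-- `f` is a bijective morphism between finitely generated right ideals. -/
def IsFGMorphism (f : Str n ≃. Str n) : Prop :=
  IsMorphism f ∧ (∃ X : Set (Str n), X.Finite ∧ domain f = rightIdeal X) ∧
    ∃ Y : Set (Str n), Y.Finite ∧ domain f.symm = rightIdeal Y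

/-- `f` is a bijective morphism between principal right ideals. -/
def IsPrincipalMorphism (f : Str n ≃. Str n) : Prop :=
  IsMorphism f ∧ (∃ y : Str n, domain f = rightIdeal {y}) ∧
    ∃ x : Str n, domain f.symm = rightIdeal {x}

theorem IsMorphism.symm {f : Str n ≃. Str n} (h : IsMorphism f) : IsMorphism f.symm := by
  intro r t s hr
  rw [PEquiv.mem_iff_mem] at hr ⊢
  exact h _ _ _ hr

theorem IsMorphism.trans {f g : Str n ≃. Str n} (hf : IsMorphism f) (hg : IsMorphism g) :
    IsMorphism (g.trans f) := by
  intro r t s hr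
  rw [PEquiv.mem_trans] at hr ⊢
  obtain ⟨b, hb, ht⟩ := hr
  exact ⟨b ++ s, hg _ _ _ hb, hf _ _ _ ht⟩

theorem isMorphism_refl : IsMorphism (PEquiv.refl (Str n)) := by
  intro r t s h
  simp only [PEquiv.refl_apply, Option.mem_some_iff] at h ⊢
  rw [h]

theorem isMorphism_bot : IsMorphism (⊥ : Str n ≃. Str n) := by
  intro r t s h
  simp at h

theorem domain_refl : domain (PEquiv.refl (Str n)) = rightIdeal {[]} := by
  ext z
  simp [domain, rightIdeal]

theorem domain_bot : domain (⊥ : Str n ≃. Str n) = ∅ := by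
  ext z
  simp [domain]

theorem eq_bot_of_domain {f : Str n ≃. Str n} (h : domain f = ∅) : f = ⊥ := by
  apply PEquiv.ext
  intro x
  rw [PEquiv.bot_apply, Option.eq_none_iff_forall_not_mem]
  intro y hy
  have : x ∈ domain f := ⟨y, hy⟩
  rw [h] at this
  exact this

theorem rightIdeal_inter (X V : Set (Str n)) :
    rightIdeal X ∩ rightIdeal V =
      rightIdeal ((X ∩ rightIdeal V) ∪ (V ∩ rightIdeal X)) := by
  ext z
  constructor
  · rintro ⟨⟨x, hx, u, rfl⟩, ⟨v, hv, w, hw⟩⟩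
    rcases List.prefix_or_prefix_of_prefix (List.prefix_append x u)
      (hw ▸ List.prefix_append v w) with ⟨t, ht⟩ | ⟨t, ht⟩
    · exact ⟨v, Or.inr ⟨hv, x, hx, t, ht.symm⟩, w, hw⟩
    · exact ⟨x, Or.inl ⟨hx, v, hv, t, ht.symm⟩, u, rfl⟩
  · rintro ⟨a, ⟨ha, b, hb, t, rfl⟩ | ⟨ha, b, hb, t, rfl⟩, u, rfl⟩
    · exact ⟨⟨_, ha, u, rfl⟩, ⟨b, hb, t ++ u, by simp⟩⟩
    · exact ⟨⟨b, hb, t ++ u, by simp⟩, ⟨_, ha, u, rfl⟩⟩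

theorem domain_trans {f g : Str n ≃. Str n} (hg : IsMorphism g) {W : Set (Str n)}
    (hW : domain f ∩ domain g.symm = rightIdeal W) :
    domain (g.trans f) = rightIdeal {z | ∃ w ∈ W, w ∈ g z} := by
  have hsub : ∀ z b, b ∈ g z → (z ∈ domain (g.trans f) ↔ b ∈ rightIdeal W) := by
    intro z b hb
    rw [← hW]
    constructor
    · rintro ⟨y, hy⟩
      rw [PEquiv.mem_trans] at hy
      obtain ⟨b', hb', hy⟩ := hy
      obtain rfl := Option.mem_unique hb hb'
      exact ⟨⟨y, hy⟩, ⟨z, (PEquiv.mem_iff_mem g).2 hb⟩⟩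
    · rintro ⟨⟨y, hy⟩, _⟩
      exact ⟨y, (PEquiv.mem_trans g f z y).2 ⟨b, hb, hy⟩⟩
  ext z
  constructor
  · intro hz
    obtain ⟨y, hy⟩ := id hz
    rw [PEquiv.mem_trans] at hy
    obtain ⟨b, hb, -⟩ := hy
    obtain ⟨w, hw, u, rfl⟩ := (hsub z b hb).1 hz
    have hw' : w ∈ rightIdeal W := ⟨w, hw, [], by simp⟩
    rw [← hW] at hw'
    obtain ⟨a, ha⟩ := hw'.2
    rw [PEquiv.mem_iff_mem] at ha
    exact ⟨a, ⟨w, hw, ha⟩, u, PEquiv.inj g hb (hg _ _ _ ha)⟩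
  · rintro ⟨a, ⟨w, hw, ha⟩, u, rfl⟩
    exact (hsub _ _ (hg _ _ u ha)).2 ⟨w, hw, u, rfl⟩

theorem finite_preimage (g : Str n ≃. Str n) {W : Set (Str n)} (hW : W.Finite) :
    {z | ∃ w ∈ W, w ∈ g z}.Finite := by
  refine (hW.image (fun w => (g.symm w).getD [])).subset ?_
  rintro z ⟨w, hw, hz⟩
  refine ⟨w, hw, ?_⟩
  have : g.symm w = some z := (PEquiv.mem_iff_mem g).2 hz
  simp [this]

theorem fg_domain_trans {f g : Str n ≃. Str n} (hg : IsMorphism g)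
    (h1 : ∃ X : Set (Str n), X.Finite ∧ domain f = rightIdeal X)
    (h2 : ∃ Y : Set (Str n), Y.Finite ∧ domain g.symm = rightIdeal Y) :
    ∃ Z : Set (Str n), Z.Finite ∧ domain (g.trans f) = rightIdeal Z := by
  obtain ⟨X, hX, hfX⟩ := h1
  obtain ⟨Y, hY, hgY⟩ := h2
  exact ⟨_, finite_preimage g ((hX.inter_of_left _).union (hY.inter_of_left _)),
    domain_trans hg (by rw [hfX, hgY]; exact rightIdeal_inter X Y)⟩

theorem IsFGMorphism.symm {f : Str n ≃. Str n} (h : IsFGMorphism f) : IsFGMorphism f.symm :=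
  ⟨h.1.symm, h.2.2, h.2.1⟩

theorem IsFGMorphism.trans {f g : Str n ≃. Str n} (hf : IsFGMorphism f) (hg : IsFGMorphism g) :
    IsFGMorphism (g.trans f) := by
  refine ⟨hf.1.trans hg.1, fg_domain_trans hg.1 hf.2.1 hg.2.2, ?_⟩
  rw [PEquiv.symm_trans_rev]
  exact fg_domain_trans hf.1.symm hg.2.2 hf.2.1

theorem principal_inter (x v : Str n) :
    rightIdeal {x} ∩ rightIdeal {v} = ∅ ∨
      ∃ w, rightIdeal {x} ∩ rightIdeal {v} = rightIdeal {w} := by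
  rw [rightIdeal_inter]
  by_cases h1 : x ∈ rightIdeal {v}
  · right
    refine ⟨x, ?_⟩
    rw [← rightIdeal_inter]
    refine Set.inter_eq_left.2 ?_
    obtain ⟨v', rfl, t, rfl⟩ := h1
    rintro z ⟨x', rfl, u, rfl⟩
    exact ⟨v', rfl, t ++ u, by simp⟩
  · by_cases h2 : v ∈ rightIdeal {x}
    · right
      refine ⟨v, ?_⟩
      rw [← rightIdeal_inter]
      refine Set.inter_eq_right.2 ?_
      obtain ⟨v', rfl, t, rfl⟩ := h2
      rintro z ⟨x', rfl, u, rfl⟩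
      exact ⟨v', rfl, t ++ u, by simp⟩
    · left
      ext z
      simp only [Set.mem_empty_iff_false, iff_false]
      rintro ⟨a, ⟨rfl, h⟩ | ⟨rfl, h⟩, -⟩
      · exact h1 h
      · exact h2 h

theorem principal_domain_trans {f g : Str n ≃. Str n} (hg : IsMorphism g)
    (h1 : ∃ x : Str n, domain f = rightIdeal {x})
    (h2 : ∃ y : Str n, domain g.symm = rightIdeal {y}) :
    g.trans f = ⊥ ∨ ∃ z : Str n, domain (g.trans f) = rightIdeal {z} := by
  obtain ⟨x, hx⟩ := h1
  obtain ⟨y, hy⟩ := h2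
  rcases principal_inter x y with h | ⟨w, h⟩
  · left
    apply eq_bot_of_domain
    rw [← hx, ← hy] at h
    rw [domain_trans (W := ∅) hg (by rw [h]; ext; simp [rightIdeal])]
    ext
    simp [rightIdeal]
  · right
    rw [← hx, ← hy] at h
    have hw : w ∈ domain f ∩ domain g.symm := by
      rw [h]
      exact ⟨w, rfl, [], by simp⟩
    obtain ⟨a, ha⟩ := hw.2
    refine ⟨a, ?_⟩
    rw [domain_trans hg h]
    congr 1
    ext z
    rw [PEquiv.mem_iff_mem] at ha
    constructor
    · rintro ⟨w', rfl, hz⟩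
      exact PEquiv.inj g hz ha
    · rintro rfl
      exact ⟨w, rfl, ha⟩

/-- The empty partial function or a bijective morphism between principal right ideals. -/
def IsPolycyclic (f : Str n ≃. Str n) : Prop := f = ⊥ ∨ IsPrincipalMorphism f

theorem IsPolycyclic.symm {f : Str n ≃. Str n} (h : IsPolycyclic f) : IsPolycyclic f.symm := by
  rcases h with rfl | h
  · exact Or.inl PEquiv.symm_bot
  · exact Or.inr ⟨h.1.symm, h.2.2, h.2.1⟩

theorem IsPolycyclic.trans {f g : Str n ≃. Str n} (hf : IsPolycyclic f) (hg : IsPolycyclic g) :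
    IsPolycyclic (g.trans f) := by
  rcases hf with rfl | hf
  · exact Or.inl (PEquiv.trans_bot g)
  rcases hg with rfl | hg
  · exact Or.inl (PEquiv.bot_trans f)
  rcases principal_domain_trans hg.1 hf.2.1 hg.2.2 with h | h
  · exact Or.inl h
  rcases principal_domain_trans hf.1.symm hg.2.2 hf.2.1 with h' | h'
  · rw [← PEquiv.symm_trans_rev] at h'
    left
    rw [← PEquiv.symm_symm (g.trans f), h', PEquiv.symm_bot]
  · rw [← PEquiv.symm_trans_rev] at h'
    exact Or.inr ⟨hf.1.trans hg.1, h, h'⟩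

theorem IsPolycyclic.isFGMorphism {f : Str n ≃. Str n} (h : IsPolycyclic f) :
    IsFGMorphism f := by
  rcases h with rfl | ⟨h, ⟨y, hy⟩, ⟨x, hx⟩⟩
  · have h0 : (∅ : Set (Str n)) = rightIdeal ∅ := by ext; simp [rightIdeal]
    refine ⟨isMorphism_bot, ⟨∅, Set.finite_empty, ?_⟩, ⟨∅, Set.finite_empty, ?_⟩⟩
    · rw [domain_bot]; exact h0
    · rw [PEquiv.symm_bot, domain_bot]; exact h0
  · exact ⟨h, ⟨_, Set.finite_singleton y, hy⟩, ⟨_, Set.finite_singleton x, hx⟩⟩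

theorem isPolycyclic_refl : IsPolycyclic (PEquiv.refl (Str n)) :=
  Or.inr ⟨isMorphism_refl, ⟨[], domain_refl⟩, ⟨[], by rw [PEquiv.symm_refl]; exact domain_refl⟩⟩

theorem drop_aux (x y z w : Str n) :
    w ∈ (if y <+: z then some (x ++ z.drop y.length) else none) ↔
      ∃ u, z = y ++ u ∧ w = x ++ u := by
  split_ifs with h
  · obtain ⟨u, rfl⟩ := h
    simp [eq_comm]
  · simp only [Option.not_mem_none, false_iff]
    rintro ⟨u, rfl, -⟩
    exact h (List.prefix_append y u)

/-- The partial bijection `x y⁻¹`, given by `y u ↦ x u`. -/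
def strMap (x y : Str n) : Str n ≃. Str n where
  toFun z := if y <+: z then some (x ++ z.drop y.length) else none
  invFun z := if x <+: z then some (y ++ z.drop x.length) else none
  inv a b := by
    rw [← Option.mem_def, ← Option.mem_def]
    rw [drop_aux, drop_aux]
    exact exists_congr fun u => and_comm

theorem mem_strMap {x y z w : Str n} : w ∈ strMap x y z ↔ ∃ u, z = y ++ u ∧ w = x ++ u :=
  drop_aux x y z w

theorem domain_strMap (x y : Str n) : domain (strMap x y) = rightIdeal {y} := by
  ext z
  constructor
  · rintro ⟨w, hw⟩
    obtain ⟨u, rfl, -⟩ := mem_strMap.1 hw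
    exact ⟨y, rfl, u, rfl⟩
  · rintro ⟨y', rfl, u, rfl⟩
    exact ⟨x ++ u, mem_strMap.2 ⟨u, rfl, rfl⟩⟩

theorem isPolycyclic_strMap (x y : Str n) : IsPolycyclic (strMap x y) := by
  refine Or.inr ⟨?_, ⟨y, domain_strMap x y⟩, ⟨x, domain_strMap y x⟩⟩
  intro r t s h
  obtain ⟨u, rfl, rfl⟩ := mem_strMap.1 h
  exact mem_strMap.2 ⟨u ++ s, by simp, by simp⟩

variable (n)

/-- The polycyclic inverse monoid `P_n`: the bijective morphisms between principal right ideals of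
the free monoid on `n` letters, together with the empty partial function. -/
def P : Type := {f : Str n ≃. Str n // IsPolycyclic f}

instance : InverseMonoidWithZero (P n) :=
  ofPartialBijections IsPolycyclic isPolycyclic_refl (Or.inl rfl) (fun _ => IsPolycyclic.symm)
    (fun _ _ => IsPolycyclic.trans)

/-- The inverse monoid `D_n` of all bijective morphisms between finitely generated right ideals of
the free monoid on `n` letters. -/
def D : Type := {f : Str n ≃. Str n // IsFGMorphism f}

instance : InverseMonoidWithZero (D n) :=
  ofPartialBijections IsFGMorphism isPolycyclic_refl.isFGMorphism
    (IsPolycyclic.isFGMorphism (Or.inl rfl)) (fun _ => IsFGMorphism.symm)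
    (fun _ _ => IsFGMorphism.trans)

/-- The inclusion of `P_n` in `D_n`. -/
def inclusion : P n →*₀ D n where
  toFun f := ⟨f.1, f.2.isFGMorphism⟩
  map_zero' := rfl
  map_one' := rfl
  map_mul' _ _ := rfl

/-- The Cuntz inverse monoid `C_n`: the quotient of `D_n` by its Lenz congruence. -/
abbrev C : Type := LenzQuotient (D n)

/-- The natural map `ι : P_n → C_n`. -/
def ι : P n →*₀ C n := (lenzHom (D n)).comp (inclusion n)

variable {n}

/-- The generator `a_i` of `P_n`, that is the map `u ↦ a_i u`. -/
def gen (i : Fin n) : P n := ⟨strMap [i] [], isPolycyclic_strMap [i] []⟩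

end PolycyclicCuntz

universe u

/-! An element `s` of `D n` is a finite union of pieces `x y⁻¹`, one over each generator `y` of its
domain, so `θ` should extend by sending `s` to the join of all `θ p` with `p ≤ s` in `P n`. This
join exists and is distributive because, together with `0`, the finitely many pieces over generators
are cofinal among all such `p` (`exists_isDistribLUB_imagesBelow`).

The extension must respect the Lenz congruence. In `D n`, `s` lies Lenz-below `t` exactly when `t`
agrees with `s` on all sufficiently long strings in the domain of `s` (`lenzLE_iff`). Multiplying
the hypothesis by `θ x` on the left and `θ y⁻¹` on the right shows that `θ (x y⁻¹)` is the join of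
the `θ (x aᵢ (y aᵢ)⁻¹)` (`isLUB_strElt_append`). Pieces can therefore be lengthened at will, and
short strings do not matter.

Multiplicativity is distributivity in `B`. Compatibility lifts from `C n` to `D n`, so joins in `C
n` are unions of graphs; this makes `C n` Boolean and makes the extension preserve joins. It is
unique because each class is a finite join of elements of `ι n`.

That `ι n` maps covers to joins follows from the definition of the Lenz relation, and `θ = ψ ∘ ι`
inherits this. Conversely, the `aᵢ aᵢ⁻¹` cover `1`, so every cover-to-join map satisfies the
hypothesis, which gives the universal property. -/

namespace InverseMonoidWithZero

/-! ### Natural order, compatibility and homomorphisms -/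

section Order

variable {S T : Type*} [InverseMonoidWithZero S] [InverseMonoidWithZero T]

/-- Turns idempotency into an inequality, so that a join of idempotents is seen to be idempotent by
a least-upper-bound argument. -/
theorem le_one_iff {e : S} : e ≤ 1 ↔ IsIdempotentElem e := by
  rw [le_iff_right]
  constructor
  · rintro ⟨f, hf, rfl⟩
    rw [one_mul]
    exact hf
  · intro h
    exact ⟨e, h, (one_mul e).symm⟩

theorem map_inv' (θ : S →*₀ T) (a : S) : θ a⁻¹ = (θ a)⁻¹ :=
  inv_unique _ _ (by rw [← map_mul, ← map_mul, mul_inv_mul])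
    (by rw [← map_mul, ← map_mul, inv_mul_inv])

theorem map_le_map (θ : S →*₀ T) {a b : S} (h : a ≤ b) : θ a ≤ θ b := by
  rw [le_def] at h ⊢
  rw [← map_inv', ← map_mul, ← map_mul, ← h]

theorem le_of_map_le (θ : S →*₀ T) (hθ : Function.Injective θ) {a b : S} (h : θ a ≤ θ b) :
    a ≤ b := by
  rw [le_def] at h ⊢
  rw [← map_inv', ← map_mul, ← map_mul] at h
  exact hθ h

theorem Compatible.of_le {a b c : S} (ha : a ≤ c) (hb : b ≤ c) : Compatible a b := by
  constructor
  · rw [← le_one_iff]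
    exact (mul_le_mul'' (inv_le_inv'' ha) hb).trans (le_one_iff.2 (inv_mul_idem c))
  · rw [← le_one_iff]
    exact (mul_le_mul'' ha (inv_le_inv'' hb)).trans (le_one_iff.2 (mul_inv_idem c))

theorem Compatible.map (θ : S →*₀ T) {a b : S} (h : Compatible a b) :
    Compatible (θ a) (θ b) := by
  constructor
  · rw [← map_inv', ← map_mul]
    exact h.1.map θ
  · rw [← map_inv', ← map_mul]
    exact h.2.map θ

theorem Compatible.of_map (θ : S →*₀ T) (hθ : Function.Injective θ) {a b : S}
    (h : Compatible (θ a) (θ b)) : Compatible a b := by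
  constructor
  · apply hθ
    have := h.1
    rwa [← map_inv', ← map_mul, IsIdempotentElem, ← map_mul] at this
  · apply hθ
    have := h.2
    rwa [← map_inv', ← map_mul, IsIdempotentElem, ← map_mul] at this

theorem isGLB_mul_of_idem {e f : S} (he : IsIdempotentElem e) (hf : IsIdempotentElem f) :
    IsGLB {e, f} (e * f) := by
  constructor
  · rintro x (rfl | rfl)
    · exact le_iff_right.2 ⟨f, hf, rfl⟩
    · exact le_iff_left.2 ⟨e, he, rfl⟩
  · intro x hx
    have h1 : x ≤ e := hx (by simp)
    have h2 : x ≤ f := hx (by simp)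
    have := mul_le_mul'' h1 h2
    have hx : x * x = x := le_one_iff.1 (h1.trans (le_one_iff.2 he))
    rwa [hx] at this

end Order

/-! ### Finite joins in distributive inverse monoids -/

section Joins

variable {S T : Type*} [InverseMonoidWithZero S] [InverseMonoidWithZero T]

/-- `j` is the join of `A`, and left and right multiplication distribute over this join. -/
def IsDistribLUB (A : Set S) (j : S) : Prop :=
  IsLUB A j ∧ ∀ c : S, IsLUB ((fun a => c * a) '' A) (c * j) ∧ IsLUB ((fun a => a * c) '' A) (j * c)

theorem isLUB_empty' : IsLUB (∅ : Set S) 0 := ⟨by simp, fun b _ => zero_le' b⟩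

theorem isLUB_insert_of {A : Set S} {a j k : S} (hj : IsLUB A j) (hk : IsLUB {a, j} k) :
    IsLUB (insert a A) k := by
  constructor
  · rintro x (rfl | hx)
    · exact hk.1 (by simp)
    · exact (hj.1 hx).trans (hk.1 (by simp))
  · intro b hb
    refine hk.2 ?_
    rintro x (rfl | rfl)
    · exact hb (by simp)
    · exact hj.2 fun y hy => hb (by simp [hy])

theorem isLUB_pair_of_insert {A : Set S} {a j k : S} (hj : IsLUB A j)
    (hk : IsLUB (insert a A) k) : IsLUB {a, j} k := by
  constructor
  · rintro x (rfl | rfl)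
    · exact hk.1 (by simp)
    · exact hj.2 fun y hy => hk.1 (by simp [hy])
  · intro b hb
    refine hk.2 ?_
    rintro x (rfl | hx)
    · exact hb (by simp)
    · exact (hj.1 hx).trans (hb (by simp))

/-- Induction on the set. Distributivity is carried along because it is what makes the new element
`a` compatible with the join `j` of the others: `a⁻¹ j` is the join of the idempotents `a⁻¹ x`. -/
theorem exists_isDistribLUB (hS : IsDistributive S) {A : Set S} (hA : A.Finite)
    (hc : ∀ a ∈ A, ∀ b ∈ A, Compatible a b) : ∃ j, IsDistribLUB A j := by
  induction A, hA using Set.Finite.induction_on with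
  | empty =>
    refine ⟨0, isLUB_empty', fun c => ?_⟩
    rw [Set.image_empty, Set.image_empty, mul_zero, zero_mul]
    exact ⟨isLUB_empty', isLUB_empty'⟩
  | @insert a A ha hA ih =>
    obtain ⟨j, hj, hjc⟩ := ih fun x hx y hy => hc x (by simp [hx]) y (by simp [hy])
    have haj : Compatible a j := by
      constructor
      · rw [← le_one_iff]
        refine (hjc a⁻¹).1.2 ?_
        rintro _ ⟨x, hx, rfl⟩
        exact le_one_iff.2 (hc a (by simp) x (by simp [hx])).1
      -- Distributivity applies to `j a⁻¹`, not to `a j⁻¹`; the latter is its inverse, and an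
      -- idempotent is its own inverse.
      · have h : IsIdempotentElem (j * a⁻¹) := by
          rw [← le_one_iff]
          refine (hjc a⁻¹).2.2 ?_
          rintro _ ⟨x, hx, rfl⟩
          exact le_one_iff.2 (hc x (by simp [hx]) a (by simp)).2
        have h' := idem_inv h
        rw [mul_inv_rev', inv_inv'] at h'
        rwa [h']
    obtain ⟨k, hk⟩ := hS.1 a j haj
    refine ⟨k, isLUB_insert_of hj hk, fun c => ?_⟩
    rw [Set.image_insert_eq, Set.image_insert_eq]
    have := hS.2 a j k c haj hk
    exact ⟨isLUB_insert_of (hjc c).1 this.1, isLUB_insert_of (hjc c).2 this.2⟩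

theorem IsLUB.isDistribLUB (hS : IsDistributive S) {A : Set S} (hA : A.Finite)
    (hc : ∀ a ∈ A, ∀ b ∈ A, Compatible a b) {j : S} (hj : IsLUB A j) : IsDistribLUB A j := by
  obtain ⟨k, hk⟩ := exists_isDistribLUB hS hA hc
  rwa [hj.unique hk.1]

theorem isLUB_of_cofinal {A A' : Set S} {j : S} (h : A ⊆ A') (h' : ∀ a ∈ A', ∃ b ∈ A, a ≤ b)
    (hj : IsLUB A j) : IsLUB A' j := by
  constructor
  · intro a ha
    obtain ⟨b, hb, hab⟩ := h' a ha
    exact hab.trans (hj.1 hb)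
  · exact fun b hb => hj.2 fun x hx => hb (h hx)

/-- Allows a finite set, where joins exist, to be replaced by the possibly infinite set of all
images below an element. -/
theorem IsDistribLUB.of_cofinal {A A' : Set S} {j : S} (h : A ⊆ A')
    (h' : ∀ a ∈ A', ∃ b ∈ A, a ≤ b) (hj : IsDistribLUB A j) : IsDistribLUB A' j := by
  refine ⟨isLUB_of_cofinal h h' hj.1, fun c => ⟨isLUB_of_cofinal (Set.image_mono h) ?_ (hj.2 c).1,
    isLUB_of_cofinal (Set.image_mono h) ?_ (hj.2 c).2⟩⟩
  · rintro _ ⟨a, ha, rfl⟩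
    obtain ⟨b, hb, hab⟩ := h' a ha
    exact ⟨_, ⟨b, hb, rfl⟩, mul_le_mul'' le_rfl hab⟩
  · rintro _ ⟨a, ha, rfl⟩
    obtain ⟨b, hb, hab⟩ := h' a ha
    exact ⟨_, ⟨b, hb, rfl⟩, mul_le_mul'' hab le_rfl⟩

theorem IsJoinMorphism.map_isLUB (hS : IsDistributive S) {ψ : S →*₀ T} (hψ : IsJoinMorphism ψ)
    {A : Set S} (hA : A.Finite) {j : S} (hj : IsLUB A j) : IsLUB (ψ '' A) (ψ j) := by
  induction A, hA using Set.Finite.induction_on generalizing j with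
  | empty =>
    rw [Set.image_empty, hj.unique isLUB_empty', map_zero]
    exact isLUB_empty'
  | @insert a A ha hA ih =>
    have hle : ∀ x ∈ A, x ≤ j := fun x hx => hj.1 (by simp [hx])
    -- The smaller set has a join because `j` bounds it, which makes its elements pairwise
    -- compatible.
    obtain ⟨k, hk, -⟩ := exists_isDistribLUB hS hA fun x hx y hy =>
      Compatible.of_le (hle x hx) (hle y hy)
    have hkj : k ≤ j := hk.2 hle
    rw [Set.image_insert_eq]
    exact isLUB_insert_of (ih hk)
      (hψ a k j (Compatible.of_le (hj.1 (by simp)) hkj) (isLUB_pair_of_insert hk hj))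

theorem IsJoinMorphism.isCoverToJoin_comp {R : Type*} [InverseMonoidWithZero R]
    (hS : IsDistributive S) {ψ : S →*₀ T} (hψ : IsJoinMorphism ψ) {φ : R →*₀ S}
    (hφ : IsCoverToJoin φ) : IsCoverToJoin (ψ.comp φ) := by
  intro a X hX
  have := hψ.map_isLUB hS (hX.1.image φ) (hφ a X hX)
  rwa [← Set.image_comp] at this

/-- A distributive inverse monoid in which all idempotents have complements is Boolean. -/
theorem isBoolean_of_complements (hS : IsDistributive S)
    (hc : ∀ e : S, IsIdempotentElem e → ∃ f, IsIdempotentElem f ∧ e * f = 0 ∧ IsLUB {e, f} 1) :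
    IsBoolean S := by
  refine ⟨hS, ?_⟩
  have hcomp : ∀ e f : {e : S // IsIdempotentElem e}, Compatible (e : S) f := fun e f =>
    Compatible.of_le (le_one_iff.2 e.2) (le_one_iff.2 f.2)
  choose sup hsup using fun e f : {e : S // IsIdempotentElem e} => hS.1 e f (hcomp e f)
  have hsup1 : ∀ e f, IsIdempotentElem (sup e f) := fun e f =>
    le_one_iff.1 ((hsup e f).2 (by
      rintro x (rfl | rfl)
      · exact le_one_iff.2 e.2
      · exact le_one_iff.2 f.2))
  let L : Lattice {e : S // IsIdempotentElem e} :=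
    { (inferInstance : PartialOrder {e : S // IsIdempotentElem e}) with
      sup := fun e f => ⟨sup e f, hsup1 e f⟩
      le_sup_left := fun e f => (hsup e f).1 (by simp)
      le_sup_right := fun e f => (hsup e f).1 (by simp)
      sup_le := fun e f g h h' => (hsup e f).2 (by
        rintro x (rfl | rfl)
        · exact h
        · exact h')
      inf := fun e f => ⟨(e : S) * f, idem_mul_idem e.2 f.2⟩
      inf_le_left := fun e f => (isGLB_mul_of_idem e.2 f.2).1 (by simp)
      inf_le_right := fun e f => (isGLB_mul_of_idem e.2 f.2).1 (by simp)
      le_inf := fun e f g h h' => (isGLB_mul_of_idem f.2 g.2).2 (by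
        rintro x (rfl | rfl)
        · exact h
        · exact h') }
  -- Meets of idempotents are products, so lattice distributivity is left distributivity of
  -- multiplication over joins.
  let DL : DistribLattice {e : S // IsIdempotentElem e} :=
    DistribLattice.ofInfSupLe fun a b c => by
      refine (hS.2 b c (sup b c) a (hcomp b c) (hsup b c)).1.2 ?_
      rintro x (rfl | rfl)
      · exact (hsup (a ⊓ b) (a ⊓ c)).1 (by left; rfl)
      · exact (hsup (a ⊓ b) (a ⊓ c)).1 (by right; rfl)
  let BO : BoundedOrder {e : S // IsIdempotentElem e} :=
    { top := ⟨1, IsIdempotentElem.one⟩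
      le_top := fun e => le_one_iff.2 e.2
      bot := ⟨0, IsIdempotentElem.zero⟩
      bot_le := fun e => zero_le' _ }
  have CL : ComplementedLattice {e : S // IsIdempotentElem e} := by
    refine ⟨fun e => ?_⟩
    obtain ⟨f, hf, h0, h1⟩ := hc e e.2
    refine ⟨⟨f, hf⟩, IsCompl.of_eq (Subtype.ext h0) (Subtype.ext ?_)⟩
    exact (hsup e ⟨f, hf⟩).unique h1
  exact ⟨DistribLattice.booleanAlgebraOfComplemented _, fun e f => Iff.rfl⟩

end Joins

/-! ### The natural order on the Lenz quotient -/

section Lenz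

variable {S : Type*} [InverseMonoidWithZero S]

theorem LenzLE.of_le {s t : S} (h : s ≤ t) : LenzLE s t :=
  fun x hx hxs => ⟨x, pos_iff.1 hx, le_rfl, hxs.trans h⟩

theorem lenzHom_eq_iff {s t : S} : lenzHom S s = lenzHom S t ↔ LenzLE s t ∧ LenzLE t s :=
  Con.eq (lenzCon S)

theorem lenzHom_surjective : Function.Surjective (lenzHom S) := by
  rintro ⟨s⟩
  exact ⟨s, rfl⟩

/-- By definition the left side says that `s` and `t s⁻¹ s` are congruent. Since `t s⁻¹ s` is a
restriction of `t`, one half of this contains the Lenz inequality; the content is that the other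
half follows from it. -/
theorem lenzHom_le_iff {s t : S} : lenzHom S s ≤ lenzHom S t ↔ LenzLE s t := by
  rw [le_def, ← map_inv', ← map_mul, ← map_mul, lenzHom_eq_iff]
  have hle : t * s⁻¹ * s ≤ t := by
    rw [mul_assoc]
    exact le_iff_right.2 ⟨_, inv_mul_idem s, rfl⟩
  constructor
  · exact fun h => h.1.trans (LenzLE.of_le hle)
  · intro h
    constructor
    · have := h.mul_right (s⁻¹ * s)
      rwa [← mul_assoc, ← mul_assoc, mul_inv_mul] at this
    · intro x hx hxt
      obtain ⟨e, he, hxe⟩ := le_iff_right.1 hxt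
      have hx1 : x * (s⁻¹ * s) = x := by
        calc x * (s⁻¹ * s) = t * s⁻¹ * s * (e * (s⁻¹ * s)) := by rw [hxe]; simp only [mul_assoc]
          _ = t * (s⁻¹ * s * s⁻¹) * s * e := by
            rw [idem_comm he (inv_mul_idem s)]; simp only [mul_assoc]
          _ = x := by rw [inv_mul_inv, hxe]
      have hxx : x = t * (x⁻¹ * x) := by
        rw [← mul_assoc]
        exact hxt.trans hle
      -- The Lenz inequality is applied to `s` restricted to the domain of `x`. The resulting `z`
      -- lies below `t` and has its domain inside that of `x`, where `t` coincides with `x`; hence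
      -- `z ≤ x`.
      have hy : s * (x⁻¹ * x) ≠ 0 := by
        intro h0
        apply pos_iff.1 hx
        calc x = x * (x⁻¹ * x) * (s⁻¹ * s) := by
              rw [← mul_assoc x x⁻¹ x, mul_inv_mul, hx1]
          _ = x * (s⁻¹ * s) * (x⁻¹ * x) := by
            rw [mul_assoc x, idem_comm (inv_mul_idem x) (inv_mul_idem s), ← mul_assoc x]
          _ = x * s⁻¹ * (s * (x⁻¹ * x)) := by simp only [mul_assoc]
          _ = 0 := by rw [h0, mul_zero]
      have hys : s * (x⁻¹ * x) ≤ s := le_iff_right.2 ⟨_, inv_mul_idem x, rfl⟩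
      obtain ⟨z, hz, hzy, hzt⟩ := h _ (pos_iff.2 hy) hys
      refine ⟨z, hz, ?_, hzy.trans hys⟩
      have hze : z * (x⁻¹ * x) = z := by
        obtain ⟨f, hf, hzf⟩ := le_iff_left.1 hzy
        calc z * (x⁻¹ * x) = f * (s * ((x⁻¹ * x) * (x⁻¹ * x))) := by
              rw [hzf]; simp only [mul_assoc]
          _ = z := by rw [inv_mul_idem, ← hzf]
      rw [← hze]
      calc z * (x⁻¹ * x) ≤ t * (x⁻¹ * x) := mul_le_mul'' hzt le_rfl
        _ = x := hxx.symm

end Lenz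

end InverseMonoidWithZero

namespace PolycyclicCuntz

open InverseMonoidWithZero

variable {n : ℕ}

/-! ### Elements of `D n` as partial maps, and the elements `x y⁻¹` -/

section PartialMaps

theorem mem_mul_D {f g : D n} {w y : Str n} :
    y ∈ (f * g).1 w ↔ ∃ z, z ∈ g.1 w ∧ y ∈ f.1 z := PEquiv.mem_trans _ _ _ _

theorem mem_inv_D {f : D n} {w y : Str n} : y ∈ (f⁻¹).1 w ↔ w ∈ f.1 y :=
  PEquiv.mem_iff_mem f.1

theorem ext_D {f g : D n} (h : ∀ w y, y ∈ f.1 w ↔ y ∈ g.1 w) : f = g :=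
  Subtype.ext (PEquiv.ext fun w => Option.ext fun y => h w y)

theorem mem_one_D {w y : Str n} : y ∈ (1 : D n).1 w ↔ w = y := by
  change y ∈ (PEquiv.refl (Str n)) w ↔ _
  simp

theorem not_mem_zero_D {w y : Str n} : y ∉ (0 : D n).1 w := by
  change y ∉ (⊥ : Str n ≃. Str n) w
  simp

theorem exists_mem_of_ne_zero {f : D n} (h : f ≠ 0) : ∃ w y, y ∈ f.1 w := by
  by_contra! h'
  exact h (ext_D fun w y => iff_of_false (h' w y) not_mem_zero_D)

theorem ne_zero_of_mem {f : D n} {w y : Str n} (h : y ∈ f.1 w) : f ≠ 0 := by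
  rintro rfl
  exact not_mem_zero_D h

theorem le_iff_D {f g : D n} : f ≤ g ↔ ∀ w y, y ∈ f.1 w → y ∈ g.1 w := by
  constructor
  · intro h w y hy
    rw [le_def] at h
    rw [h, mem_mul_D] at hy
    obtain ⟨z, hz, hy⟩ := hy
    obtain ⟨v, hv, hy⟩ := mem_mul_D.1 hy
    rw [mem_inv_D] at hv
    rwa [PEquiv.inj f.1 hz hv]
  · intro h
    refine le_def.2 (ext_D fun w y => ?_)
    simp only [mem_mul_D, mem_inv_D]
    constructor
    · exact fun hy => ⟨y, hy, w, hy, h w y hy⟩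
    · rintro ⟨z, hz, v, hv, hy⟩
      obtain rfl := PEquiv.inj f.1 hz hv
      rwa [Option.mem_unique hy (h _ _ hz)]

theorem inclusion_injective : Function.Injective (inclusion n) :=
  fun _ _ h => Subtype.ext (congrArg (fun d : D n => d.1) h)

theorem inclusion_le_iff {p q : P n} : inclusion n p ≤ inclusion n q ↔ p ≤ q :=
  ⟨le_of_map_le _ inclusion_injective, map_le_map _⟩

/-- The element `x y⁻¹` of the polycyclic inverse monoid. -/
def strElt (x y : Str n) : P n := ⟨strMap x y, isPolycyclic_strMap x y⟩

theorem mem_inclusion_strElt {x y w z : Str n} :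
    z ∈ (inclusion n (strElt x y)).1 w ↔ ∃ u, w = y ++ u ∧ z = x ++ u := mem_strMap

theorem inclusion_strElt_ne_zero (x y : Str n) : inclusion n (strElt x y) ≠ 0 :=
  ne_zero_of_mem (mem_inclusion_strElt.2 ⟨[], rfl, rfl⟩)

/-- A morphism is determined on the ideal of `y` by its value at `y`. Thus the nonzero elements of
`P n` below `s` correspond to the points of the graph of `s`. -/
theorem inclusion_strElt_le_iff {x y : Str n} {s : D n} :
    inclusion n (strElt x y) ≤ s ↔ x ∈ s.1 y := by
  rw [le_iff_D]
  constructor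
  · intro h
    exact h y x (mem_inclusion_strElt.2 ⟨[], by simp, by simp⟩)
  · intro h w z hz
    obtain ⟨u, rfl, rfl⟩ := mem_inclusion_strElt.1 hz
    exact s.2.1 _ _ _ h

theorem ext_P {p q : P n} (h : ∀ w y, y ∈ p.1 w ↔ y ∈ q.1 w) : p = q :=
  inclusion_injective (ext_D h)

theorem eq_zero_or_eq_strElt (p : P n) : p = 0 ∨ ∃ x y, p = strElt x y := by
  rcases p.2 with h | ⟨h, ⟨y, hy⟩, -⟩
  · exact Or.inl (Subtype.ext h)
  · right
    have hyd : y ∈ domain p.1 := by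
      rw [hy]
      exact ⟨y, rfl, [], by simp⟩
    obtain ⟨x, hx⟩ := hyd
    refine ⟨x, y, ext_P fun w z => ?_⟩
    rw [show z ∈ (strElt x y).1 w ↔ _ from mem_strMap]
    constructor
    · intro hz
      have hw : w ∈ domain p.1 := ⟨z, hz⟩
      rw [hy] at hw
      obtain ⟨_, rfl, u, rfl⟩ := hw
      exact ⟨u, rfl, Option.mem_unique hz (h _ _ u hx)⟩
    · rintro ⟨u, rfl, rfl⟩
      exact h _ _ _ hx

theorem strElt_mul_strElt (x y z : Str n) : strElt x y * strElt y z = strElt x z := by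
  apply inclusion_injective
  rw [map_mul]
  refine ext_D fun w v => ?_
  simp only [mem_mul_D, mem_inclusion_strElt]
  constructor
  · rintro ⟨_, ⟨u, rfl, rfl⟩, u', h, rfl⟩
    rw [List.append_cancel_left h]
    exact ⟨u', rfl, rfl⟩
  · rintro ⟨u, rfl, rfl⟩
    exact ⟨_, ⟨u, rfl, rfl⟩, u, rfl, rfl⟩

theorem gen_mul_inv (i : Fin n) : gen i * (gen i)⁻¹ = strElt [i] [i] :=
  strElt_mul_strElt [i] [] [i]

theorem strElt_mul_gen_mul (x y : Str n) (i : Fin n) :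
    strElt x [] * (gen i * (gen i)⁻¹) * strElt [] y = strElt (x ++ [i]) (y ++ [i]) := by
  rw [gen_mul_inv]
  apply inclusion_injective
  rw [map_mul, map_mul]
  refine ext_D fun w v => ?_
  simp only [mem_mul_D, mem_inclusion_strElt]
  constructor
  · rintro ⟨_, ⟨u, rfl, rfl⟩, _, ⟨u', h, rfl⟩, u'', h', rfl⟩
    simp only [List.nil_append] at h h'
    subst h'
    subst h
    exact ⟨u', by simp, by simp⟩
  · rintro ⟨u, rfl, rfl⟩
    exact ⟨[i] ++ u, ⟨[i] ++ u, by simp, by simp⟩, [i] ++ u, ⟨u, by simp, by simp⟩,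
      [i] ++ u, by simp, by simp⟩

end PartialMaps

/-! ### The Lenz relation in terms of long strings -/

section Ideals

theorem isFGMorphism_ofSet {X : Set (Str n)} (hX : X.Finite)
    [DecidablePred fun w => w ∈ rightIdeal X] : IsFGMorphism (PEquiv.ofSet (rightIdeal X)) := by
  have hd : domain (PEquiv.ofSet (rightIdeal X)) = rightIdeal X := by
    ext z
    simp only [domain, PEquiv.mem_ofSet_iff, Set.mem_ofPred_eq]
    exact ⟨fun ⟨_, rfl, h⟩ => h, fun h => ⟨z, rfl, h⟩⟩
  refine ⟨?_, ⟨X, hX, hd⟩, X, hX, by rw [PEquiv.ofSet_symm, hd]⟩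
  intro r t s h
  rw [PEquiv.mem_ofSet_iff] at h ⊢
  obtain ⟨rfl, x, hx, u, rfl⟩ := h
  exact ⟨rfl, x, hx, u ++ s, by simp⟩

open Classical in
/-- The idempotent of `D_n` with domain the right ideal generated by a finite set. -/
noncomputable def idealElt (X : Set (Str n)) (hX : X.Finite) : D n :=
  ⟨PEquiv.ofSet (rightIdeal X), isFGMorphism_ofSet hX⟩

theorem mem_idealElt {X : Set (Str n)} {hX : X.Finite} {w y : Str n} :
    y ∈ (idealElt X hX).1 w ↔ w = y ∧ y ∈ rightIdeal X := by
  classical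
  rw [eq_comm]
  exact PEquiv.mem_ofSet_iff

theorem exists_length_bound {X : Set (Str n)} (hX : X.Finite) :
    ∃ N, ∀ x ∈ X, x.length ≤ N := by
  obtain ⟨N, hN⟩ := (hX.image List.length).bddAbove
  exact ⟨N, fun x hx => hN ⟨x, hx, rfl⟩⟩

/-- Take `N` to bound the lengths of the generators of the domain: a generator that is a prefix of
`w ++ u` is then already a prefix of `w`. -/
theorem exists_mem_domain_of_append (s : D n) :
    ∃ N, ∀ w u : Str n, N ≤ w.length → w ++ u ∈ domain s.1 → w ∈ domain s.1 := by
  obtain ⟨-, ⟨X, hX, hd⟩, -⟩ := s.2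
  obtain ⟨N, hN⟩ := exists_length_bound hX
  refine ⟨N, fun w u hw h => ?_⟩
  rw [hd] at h ⊢
  obtain ⟨x, hx, v, hv⟩ := h
  obtain ⟨t, rfl⟩ : x <+: w := List.prefix_of_prefix_length_le (hv ▸ List.prefix_append x v)
    (List.prefix_append w u) ((hN x hx).trans hw)
  exact ⟨x, hx, t, rfl⟩

theorem lenzLE_iff [NeZero n] {s t : D n} :
    LenzLE s t ↔ ∃ N, ∀ w y : Str n, N ≤ w.length → y ∈ s.1 w → y ∈ t.1 w := by
  constructor
  · intro h
    obtain ⟨N, hN⟩ := exists_mem_domain_of_append t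
    refine ⟨N, fun w y hw hy => ?_⟩
    obtain ⟨z, hz, hzx, hzt⟩ := h _ (pos_iff.2 (inclusion_strElt_ne_zero y w))
      (inclusion_strElt_le_iff.2 hy)
    obtain ⟨a, b, hb⟩ := exists_mem_of_ne_zero hz
    obtain ⟨u, rfl, rfl⟩ := mem_inclusion_strElt.1 (le_iff_D.1 hzx _ _ hb)
    have hb' := le_iff_D.1 hzt _ _ hb
    -- `t` is defined at `w ++ u`, hence at the long string `w`; cancelling `u` from the values
    -- identifies `t w` with `y`.
    obtain ⟨v, hv⟩ := hN w u hw ⟨_, hb'⟩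
    have := Option.mem_unique hb' (t.2.1 _ _ u hv)
    rwa [List.append_cancel_right this]
  · rintro ⟨N, hN⟩ x hx hxs
    obtain ⟨w, y, hy⟩ := exists_mem_of_ne_zero (pos_iff.1 hx)
    -- Padding with `N` copies of a letter reaches the length at which `s` and `t` agree.
    have hy' := x.2.1 _ _ (List.replicate N 0) hy
    exact ⟨_, inclusion_strElt_ne_zero _ _, inclusion_strElt_le_iff.2 hy',
      inclusion_strElt_le_iff.2 (hN _ _ (by simp) (le_iff_D.1 hxs _ _ hy'))⟩

theorem exists_append_of_lenzLE [NeZero n] {s t : D n} (h : LenzLE s t) {w y : Str n}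
    (hy : y ∈ s.1 w) : ∃ u, y ++ u ∈ t.1 (w ++ u) := by
  obtain ⟨N, hN⟩ := lenzLE_iff.1 h
  exact ⟨List.replicate N 0, hN _ _ (by simp) (s.2.1 _ _ _ hy)⟩

/-- If `s` fixes `w ++ u` and sends `w` to `y`, cancelling `u` gives `w = y`. So the congruence is
idempotent-pure, and compatibility in `C n` lifts to representatives. -/
theorem isIdempotentElem_of_lenz [NeZero n] {s : D n}
    (h : IsIdempotentElem (lenzHom (D n) s)) : IsIdempotentElem s := by
  rw [← le_one_iff] at h ⊢
  rw [← map_one (lenzHom (D n)), lenzHom_le_iff] at h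
  rw [le_iff_D]
  intro w y hy
  obtain ⟨u, hu⟩ := exists_append_of_lenzLE h hy
  rw [mem_one_D] at hu ⊢
  exact List.append_cancel_right hu

theorem compatible_of_lenz [NeZero n] {s t : D n}
    (h : Compatible (lenzHom (D n) s) (lenzHom (D n) t)) : Compatible s t := by
  constructor
  · apply isIdempotentElem_of_lenz
    rw [map_mul, map_inv']
    exact h.1
  · apply isIdempotentElem_of_lenz
    rw [map_mul, map_inv']
    exact h.2

end Ideals

/-! ### Joins, complements and covers in `C n` -/

section Joins

theorem mem_unique_of_compatible {s t : D n} (h : Compatible s t) {w y z : Str n}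
    (hy : y ∈ s.1 w) (hz : z ∈ t.1 w) : y = z := by
  have := le_iff_D.1 (le_one_iff.2 h.2) z y (mem_mul_D.2 ⟨w, mem_inv_D.2 hz, hy⟩)
  exact (mem_one_D.1 this).symm

theorem rightIdeal_union (X Y : Set (Str n)) :
    rightIdeal (X ∪ Y) = rightIdeal X ∪ rightIdeal Y := by
  ext z
  constructor
  · rintro ⟨x, hx | hx, u, rfl⟩
    · exact Or.inl ⟨x, hx, u, rfl⟩
    · exact Or.inr ⟨x, hx, u, rfl⟩
  · rintro (⟨x, hx, u, rfl⟩ | ⟨x, hx, u, rfl⟩)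
    · exact ⟨x, Or.inl hx, u, rfl⟩
    · exact ⟨x, Or.inr hx, u, rfl⟩

theorem mem_orElse_iff {s t : D n} (h : Compatible s t) {w y : Str n} :
    y ∈ (s.1 w <|> t.1 w) ↔ y ∈ s.1 w ∨ y ∈ t.1 w := by
  rcases hs : s.1 w with _ | a
  · simp
  · constructor
    · intro hy
      exact Or.inl hy
    · rintro (hy | hy)
      · exact hy
      · rw [← mem_unique_of_compatible h hs hy]
        rfl

theorem fg_domain_of_mem_or {f g h : Str n ≃. Str n}
    (hf : ∀ w y, y ∈ f w ↔ y ∈ g w ∨ y ∈ h w)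
    (hg : ∃ X : Set (Str n), X.Finite ∧ domain g = rightIdeal X)
    (hh : ∃ X : Set (Str n), X.Finite ∧ domain h = rightIdeal X) :
    ∃ X : Set (Str n), X.Finite ∧ domain f = rightIdeal X := by
  obtain ⟨X, hX, hgX⟩ := hg
  obtain ⟨Y, hY, hhY⟩ := hh
  refine ⟨X ∪ Y, hX.union hY, ?_⟩
  rw [rightIdeal_union, ← hgX, ← hhY]
  ext w
  simp only [domain, hf, exists_or, Set.mem_ofPred_eq, Set.mem_union]

theorem IsFGMorphism.of_mem_or {f g h : Str n ≃. Str n}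
    (hf : ∀ w y, y ∈ f w ↔ y ∈ g w ∨ y ∈ h w) (hg : IsFGMorphism g) (hh : IsFGMorphism h) :
    IsFGMorphism f := by
  refine ⟨fun r t s hr => ?_, fg_domain_of_mem_or hf hg.2.1 hh.2.1,
    fg_domain_of_mem_or (fun w y => ?_) hg.2.2 hh.2.2⟩
  · rw [hf] at hr ⊢
    exact hr.imp (hg.1 _ _ _) (hh.1 _ _ _)
  · rw [PEquiv.mem_iff_mem, PEquiv.mem_iff_mem, PEquiv.mem_iff_mem]
    exact hf y w

/-- Compatible partial bijections agree where both are defined, and so do their inverses; hence the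
union of their graphs is again a partial bijection. -/
theorem exists_union {s t : D n} (h : Compatible s t) :
    ∃ j : D n, ∀ w y, y ∈ j.1 w ↔ y ∈ s.1 w ∨ y ∈ t.1 w := by
  have h' : Compatible s⁻¹ t⁻¹ := by
    constructor
    · rw [inv_inv']
      exact h.2
    · rw [inv_inv']
      exact h.1
  let f : Str n ≃. Str n :=
    { toFun := fun w => s.1 w <|> t.1 w
      invFun := fun w => (s⁻¹).1 w <|> (t⁻¹).1 w
      inv := fun a b => by
        rw [← Option.mem_def, ← Option.mem_def, mem_orElse_iff h, mem_orElse_iff h',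
          mem_inv_D, mem_inv_D] }
  have hf : ∀ w y, y ∈ f w ↔ y ∈ s.1 w ∨ y ∈ t.1 w := fun w y => mem_orElse_iff h
  exact ⟨⟨f, IsFGMorphism.of_mem_or hf s.2 t.2⟩, hf⟩

theorem lenzLE_of_mem_or [NeZero n] {s t j r : D n}
    (hj : ∀ w y, y ∈ j.1 w → y ∈ s.1 w ∨ y ∈ t.1 w) (hs : LenzLE s r) (ht : LenzLE t r) :
    LenzLE j r := by
  obtain ⟨N, hN⟩ := lenzLE_iff.1 hs
  obtain ⟨M, hM⟩ := lenzLE_iff.1 ht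
  refine lenzLE_iff.2 ⟨max N M, fun w y hw hy => ?_⟩
  rcases hj w y hy with h | h
  · exact hN w y ((le_max_left _ _).trans hw) h
  · exact hM w y ((le_max_right _ _).trans hw) h

theorem isLUB_of_mem_or [NeZero n] {s t j : D n}
    (hj : ∀ w y, y ∈ j.1 w ↔ y ∈ s.1 w ∨ y ∈ t.1 w) :
    IsLUB {lenzHom (D n) s, lenzHom (D n) t} (lenzHom (D n) j) := by
  constructor
  · rintro x (rfl | rfl)
    · exact map_le_map _ (le_iff_D.2 fun w y hy => (hj w y).2 (Or.inl hy))
    · exact map_le_map _ (le_iff_D.2 fun w y hy => (hj w y).2 (Or.inr hy))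
  · intro b hb
    obtain ⟨r, rfl⟩ := lenzHom_surjective b
    rw [lenzHom_le_iff]
    exact lenzLE_of_mem_or (fun w y => (hj w y).1) (lenzHom_le_iff.1 (hb (by simp)))
      (lenzHom_le_iff.1 (hb (by simp)))

/-- Joins are represented by unions of graphs, and composition of relations distributes over unions.
-/
theorem isDistributive_C [NeZero n] : IsDistributive (C n) := by
  refine ⟨fun a b h => ?_, fun a b j c h hj => ?_⟩
  · obtain ⟨s, rfl⟩ := lenzHom_surjective a
    obtain ⟨t, rfl⟩ := lenzHom_surjective b
    obtain ⟨j, hj⟩ := exists_union (compatible_of_lenz h)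
    exact ⟨_, isLUB_of_mem_or hj⟩
  · obtain ⟨s, rfl⟩ := lenzHom_surjective a
    obtain ⟨t, rfl⟩ := lenzHom_surjective b
    obtain ⟨c, rfl⟩ := lenzHom_surjective c
    obtain ⟨k, hk⟩ := exists_union (compatible_of_lenz h)
    rw [hj.unique (isLUB_of_mem_or hk)]
    simp only [← map_mul]
    constructor
    · refine isLUB_of_mem_or fun w y => ?_
      simp only [mem_mul_D, hk, or_and_right, exists_or]
    · refine isLUB_of_mem_or fun w y => ?_
      simp only [mem_mul_D, hk, and_or_left, exists_or]

theorem finite_setOf_length_eq_and (N : ℕ) (p : Str n → Prop) :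
    {w : Str n | w.length = N ∧ p w}.Finite :=
  (List.finite_length_eq (Fin n) N).subset fun _ h => h.1

theorem exists_complement [NeZero n] (e : C n) (he : IsIdempotentElem e) :
    ∃ f, IsIdempotentElem f ∧ e * f = 0 ∧ IsLUB {e, f} 1 := by
  obtain ⟨s, rfl⟩ := lenzHom_surjective e
  have hs : ∀ w y, y ∈ s.1 w → w = y := fun w y hy =>
    mem_one_D.1 (le_iff_D.1 (le_one_iff.2 (isIdempotentElem_of_lenz he)) w y hy)
  obtain ⟨N, hN⟩ := exists_mem_domain_of_append s
  -- The complement is the ideal generated by the strings of length `N` outside the domain of `s`.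
  -- By the choice of `N` it is disjoint from the domain, and every string of length at least `N`
  -- lies in one of the two.
  have hX := finite_setOf_length_eq_and N fun w => w ∉ domain s.1
  refine ⟨lenzHom (D n) (idealElt _ hX), ?_, ?_, ?_, ?_⟩
  · rw [← le_one_iff, ← map_one (lenzHom (D n))]
    refine map_le_map _ (le_iff_D.2 fun w y hy => mem_one_D.2 (mem_idealElt.1 hy).1)
  · rw [← map_mul, ← map_zero (lenzHom (D n))]
    congr 1
    refine ext_D fun w y => iff_of_false ?_ not_mem_zero_D
    rw [mem_mul_D]
    rintro ⟨z, hz, hy⟩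
    obtain ⟨rfl, x, ⟨hx, hxs⟩, u, rfl⟩ := mem_idealElt.1 hz
    exact hxs (hN x u hx.ge ⟨y, hy⟩)
  · rintro x (rfl | rfl)
    · exact le_one_iff.2 he
    · rw [← map_one (lenzHom (D n))]
      refine map_le_map _ (le_iff_D.2 fun w y hy => mem_one_D.2 (mem_idealElt.1 hy).1)
  · intro b hb
    obtain ⟨r, rfl⟩ := lenzHom_surjective b
    obtain ⟨K, hK⟩ := lenzLE_iff.1 (lenzHom_le_iff.1 (hb (a := lenzHom (D n) s) (by simp)))
    obtain ⟨M, hM⟩ := lenzLE_iff.1 (lenzHom_le_iff.1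
      (hb (a := lenzHom (D n) (idealElt _ hX)) (by simp)))
    rw [← map_one (lenzHom (D n)), lenzHom_le_iff, lenzLE_iff]
    refine ⟨max N (max K M), fun w y hw hy => ?_⟩
    obtain rfl := mem_one_D.1 hy
    simp only [max_le_iff] at hw
    have hlen : (w.take N).length = N := by simp [hw.1]
    have hw' : w.take N ++ w.drop N = w := List.take_append_drop N w
    by_cases h : w.take N ∈ domain s.1
    · obtain ⟨y, hy⟩ := h
      have hy' := s.2.1 _ _ (w.drop N) hy
      rw [← hs _ _ hy, hw'] at hy'
      exact hK _ _ hw.2.1 hy'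
    · exact hM _ _ hw.2.2 (mem_idealElt.2 ⟨rfl, _, ⟨hlen, h⟩, _, hw'.symm⟩)

theorem isBoolean_C [NeZero n] : IsBoolean (C n) :=
  isBoolean_of_complements isDistributive_C exists_complement

/-- Below any nonzero `x ≤ a` lies a nonzero element of `P n`. It meets some member `b` of the
cover, and an upper bound `t` is Lenz-above `b`, so `x` and `t` have a common nonzero lower bound.
-/
theorem isCoverToJoin_ι : IsCoverToJoin (ι n) := by
  intro a X hX
  constructor
  · rintro _ ⟨b, hb, rfl⟩
    exact map_le_map _ (hX.2.1 b hb)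
  · intro c hc
    obtain ⟨t, rfl⟩ := lenzHom_surjective c
    refine lenzHom_le_iff.2 fun x hx hxa => ?_
    obtain ⟨w, y, hy⟩ := exists_mem_of_ne_zero (pos_iff.1 hx)
    have hpx := inclusion_strElt_le_iff.2 hy
    have hp : strElt y w ≠ 0 := fun h => inclusion_strElt_ne_zero y w (by rw [h, map_zero])
    obtain ⟨b, hb, m, hm, hm0⟩ := hX.2.2 _ (pos_iff.2 hp) (inclusion_le_iff.1 (hpx.trans hxa))
    have hbt : LenzLE (inclusion n b) t := lenzHom_le_iff.1 (hc ⟨b, hb, rfl⟩)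
    have hm0' : inclusion n m ≠ 0 := fun h => hm0 (inclusion_injective (by rw [h, map_zero]))
    obtain ⟨z, hz, hzm, hzt⟩ := hbt _ (pos_iff.2 hm0') (map_le_map _ (hm.1 (by simp)))
    exact ⟨z, hz, (hzm.trans (map_le_map _ (hm.1 (by simp)))).trans hpx, hzt⟩

theorem isTightCover_gen [NeZero n] :
    IsTightCover (Set.range fun i : Fin n => gen i * (gen i)⁻¹) 1 := by
  refine ⟨Set.finite_range _, ?_, fun x hx hx1 => ?_⟩
  · rintro _ ⟨i, rfl⟩
    exact le_one_iff.2 (mul_inv_idem _)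
  · rcases eq_zero_or_eq_strElt x with rfl | ⟨y, z, rfl⟩
    · exact absurd rfl hx.ne
    · have hyz : z = y := by
        have := (inclusion_strElt_le_iff (s := 1)).1 (by simpa using inclusion_le_iff.2 hx1)
        exact mem_one_D.1 this
      subst hyz
      -- The string `z` may be empty; appending a letter supplies a first letter `i`, and `z ++ [0]`
      -- is in the ideals of both `z` and `aᵢ`.
      have hne : z ++ [0] ≠ [] := by simp
      obtain ⟨i, u, hu⟩ := List.exists_cons_of_ne_nil hne
      refine ⟨_, ⟨i, rfl⟩, _, isGLB_mul_of_idem (le_one_iff.1 hx1) (mul_inv_idem _), ?_⟩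
      intro h0
      have hmem : z ++ [0] ∈ (inclusion n (strElt z z * (gen i * (gen i)⁻¹))).1 (z ++ [0]) := by
        rw [gen_mul_inv, map_mul, mem_mul_D]
        exact ⟨z ++ [0], mem_inclusion_strElt.2 ⟨u, by simpa using hu, by simpa using hu⟩,
          mem_inclusion_strElt.2 ⟨[0], rfl, rfl⟩⟩
      rw [h0, map_zero] at hmem
      exact not_mem_zero_D hmem

end Joins

end PolycyclicCuntz

/-! ### Extending `θ` to `C n`, and uniqueness -/

namespace PolycyclicCuntz

open InverseMonoidWithZero

variable {n : ℕ} {B : Type u} [InverseMonoidWithZero B]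

/-- The images under `θ` of the elements of `P_n` below `s`. -/
def imagesBelow (θ : P n →*₀ B) (s : D n) : Set B := {b | ∃ p, inclusion n p ≤ s ∧ θ p = b}

/-- The elements `s(x) x⁻¹` of `P_n`, where `x` is an element of `X` in the domain of `s`. -/
def piecesOver (s : D n) (X : Set (Str n)) : Set (P n) :=
  {p | ∃ x ∈ X, ∃ y, y ∈ s.1 x ∧ p = strElt y x}

theorem finite_piecesOver (s : D n) {X : Set (Str n)} (hX : X.Finite) :
    (piecesOver s X).Finite := by
  refine (hX.image fun x => strElt ((s.1 x).getD []) x).subset ?_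
  rintro _ ⟨x, hx, y, hy, rfl⟩
  refine ⟨x, hx, ?_⟩
  rw [Option.mem_def] at hy
  simp [hy]

theorem inclusion_le_of_mem_piecesOver {s : D n} {X : Set (Str n)} {p : P n}
    (hp : p ∈ piecesOver s X) : inclusion n p ≤ s := by
  obtain ⟨x, -, y, hy, rfl⟩ := hp
  exact inclusion_strElt_le_iff.2 hy

theorem exists_le_of_inclusion_le {s : D n} {X : Set (Str n)} (hX : domain s.1 = rightIdeal X)
    {p : P n} (hp : inclusion n p ≤ s) (h0 : p ≠ 0) : ∃ q ∈ piecesOver s X, p ≤ q := by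
  obtain ⟨z, w, rfl⟩ := (eq_zero_or_eq_strElt p).resolve_left h0
  rw [inclusion_strElt_le_iff] at hp
  have hw : w ∈ domain s.1 := ⟨z, hp⟩
  rw [hX] at hw
  obtain ⟨x, hx, u, rfl⟩ := hw
  have hxd : x ∈ domain s.1 := by
    rw [hX]
    exact ⟨x, hx, [], by simp⟩
  obtain ⟨y, hy⟩ := hxd
  refine ⟨_, ⟨x, hx, y, hy, rfl⟩, inclusion_le_iff.1 (inclusion_strElt_le_iff.2 ?_)⟩
  exact mem_inclusion_strElt.2 ⟨u, rfl, Option.mem_unique hp (s.2.1 _ _ u hy)⟩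

theorem compatible_of_inclusion_le (θ : P n →*₀ B) {s : D n} {p q : P n} (hp : inclusion n p ≤ s)
    (hq : inclusion n q ≤ s) : Compatible (θ p) (θ q) :=
  ((Compatible.of_le hp hq).of_map _ inclusion_injective).map θ

theorem exists_isDistribLUB_imagesBelow (hB : IsDistributive B) (θ : P n →*₀ B) (s : D n) :
    ∃ j, IsDistribLUB (imagesBelow θ s) j := by
  obtain ⟨-, ⟨X, hX, hd⟩, -⟩ := s.2
  -- The element `0` is always below `s` but need not lie below a piece, as there are none when `s =
  -- 0`; it is added to make the finite set cofinal.
  have hle : ∀ p ∈ insert 0 (piecesOver s X), inclusion n p ≤ s := by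
    rintro p (rfl | hp)
    · rw [map_zero]
      exact zero_le' s
    · exact inclusion_le_of_mem_piecesOver hp
  obtain ⟨j, hj⟩ := exists_isDistribLUB hB (((finite_piecesOver s hX).insert 0).image θ) (by
    rintro _ ⟨p, hp, rfl⟩ _ ⟨q, hq, rfl⟩
    exact compatible_of_inclusion_le θ (hle p hp) (hle q hq))
  refine ⟨j, hj.of_cofinal ?_ ?_⟩
  · rintro _ ⟨p, hp, rfl⟩
    exact ⟨p, hle p hp, rfl⟩
  · rintro _ ⟨p, hp, rfl⟩
    by_cases h0 : p = 0
    · exact ⟨_, ⟨0, Or.inl rfl, rfl⟩, by rw [h0]⟩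
    · obtain ⟨q, hq, hpq⟩ := exists_le_of_inclusion_le hd hp h0
      exact ⟨_, ⟨q, Or.inr hq, rfl⟩, map_le_map θ hpq⟩

theorem isLUB_strElt_append (hB : IsDistributive B) {θ : P n →*₀ B}
    (hθ : IsLUB (Set.range fun i : Fin n => θ (gen i * (gen i)⁻¹)) 1) (x y : Str n) :
    IsLUB (Set.range fun i : Fin n => θ (strElt (x ++ [i]) (y ++ [i]))) (θ (strElt x y)) := by
  have hle : ∀ b ∈ Set.range fun i : Fin n => θ (gen i * (gen i)⁻¹), b ≤ 1 := hθ.1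
  have h1 := (IsLUB.isDistribLUB hB (Set.finite_range _)
    (fun a ha b hb => Compatible.of_le (hle a ha) (hle b hb)) hθ).2 (θ (strElt x []))
  have hle' : ∀ b ∈ (fun a => θ (strElt x []) * a) ''
      Set.range fun i : Fin n => θ (gen i * (gen i)⁻¹), b ≤ θ (strElt x []) * 1 := h1.1.1
  have h2 := ((IsLUB.isDistribLUB hB ((Set.finite_range _).image _)
    (fun a ha b hb => Compatible.of_le (hle' a ha) (hle' b hb)) h1.1).2 (θ (strElt [] y))).2
  rw [← Set.range_comp, ← Set.range_comp, mul_one, ← map_mul, strElt_mul_strElt] at h2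
  convert h2 using 3 with i
  simp only [Function.comp_apply]
  rw [← map_mul, ← map_mul, strElt_mul_gen_mul]

/-- Stated for upper bounds, so that congruent elements have equal sets of upper bounds and hence
equal joins. -/
theorem upperBounds_imagesBelow_of_lenzLE [NeZero n] (hB : IsDistributive B) {θ : P n →*₀ B}
    (hθ : IsLUB (Set.range fun i : Fin n => θ (gen i * (gen i)⁻¹)) 1) {s t : D n}
    (h : LenzLE s t) : upperBounds (imagesBelow θ t) ⊆ upperBounds (imagesBelow θ s) := by
  rintro b hb _ ⟨p, hp, rfl⟩
  obtain ⟨N, hN⟩ := lenzLE_iff.1 h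
  -- Here `k` bounds how many letters `y` is short of length `N`. Each induction step appends one
  -- letter to both strings, until the piece lies below `t`.
  have key : ∀ k, ∀ x y : Str n, N ≤ y.length + k → x ∈ s.1 y → θ (strElt x y) ≤ b := by
    intro k
    induction k with
    | zero =>
      exact fun x y hy hx => hb ⟨_, inclusion_strElt_le_iff.2 (hN y x hy hx), rfl⟩
    | succ k ih =>
      intro x y hy hx
      refine (isLUB_strElt_append hB hθ x y).2 ?_
      rintro _ ⟨i, rfl⟩
      exact ih _ _ (by simp; omega) (s.2.1 _ _ _ hx)
  rcases eq_zero_or_eq_strElt p with rfl | ⟨x, y, rfl⟩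
  · rw [map_zero]
    exact zero_le' b
  · exact key N x y (by omega) (inclusion_strElt_le_iff.1 hp)

theorem isLUB_imagesBelow_inclusion (θ : P n →*₀ B) (p : P n) :
    IsLUB (imagesBelow θ (inclusion n p)) (θ p) := by
  constructor
  · rintro _ ⟨q, hq, rfl⟩
    exact map_le_map θ (inclusion_le_iff.1 hq)
  · exact fun b hb => hb ⟨p, le_rfl, rfl⟩

/-- An element `x y⁻¹` below `s t` factors as `(x z⁻¹)(z y⁻¹)` with `z = t y`, which gives the upper
bound. Leastness is distributivity, used once for each factor. -/
theorem isLUB_imagesBelow_mul {θ : P n →*₀ B} {s t : D n} {a b : B}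
    (ha : IsDistribLUB (imagesBelow θ s) a) (hb : IsDistribLUB (imagesBelow θ t) b) :
    IsLUB (imagesBelow θ (s * t)) (a * b) := by
  constructor
  · rintro _ ⟨p, hp, rfl⟩
    rcases eq_zero_or_eq_strElt p with rfl | ⟨x, y, rfl⟩
    · rw [map_zero]
      exact zero_le' _
    · obtain ⟨z, hz, hx⟩ := mem_mul_D.1 (inclusion_strElt_le_iff.1 hp)
      rw [← strElt_mul_strElt x z y, map_mul]
      exact mul_le_mul'' (ha.1.1 ⟨_, inclusion_strElt_le_iff.2 hx, rfl⟩)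
        (hb.1.1 ⟨_, inclusion_strElt_le_iff.2 hz, rfl⟩)
  · intro c hc
    refine (ha.2 b).2.2 ?_
    rintro _ ⟨_, ⟨p, hp, rfl⟩, rfl⟩
    refine (hb.2 (θ p)).1.2 ?_
    rintro _ ⟨_, ⟨q, hq, rfl⟩, rfl⟩
    refine hc ⟨p * q, ?_, map_mul _ _ _⟩
    rw [map_mul]
    exact mul_le_mul'' hp hq

theorem isLUB_imagesBelow_union {θ : P n →*₀ B} {s t j : D n}
    (hj : ∀ w y, y ∈ j.1 w ↔ y ∈ s.1 w ∨ y ∈ t.1 w) {a b c : B}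
    (ha : IsLUB (imagesBelow θ s) a) (hb : IsLUB (imagesBelow θ t) b)
    (hc : IsLUB (imagesBelow θ j) c) : IsLUB {a, b} c := by
  constructor
  · rintro x (rfl | rfl)
    · refine ha.2 ?_
      rintro _ ⟨p, hp, rfl⟩
      exact hc.1 ⟨p, hp.trans (le_iff_D.2 fun w y hy => (hj w y).2 (Or.inl hy)), rfl⟩
    · refine hb.2 ?_
      rintro _ ⟨p, hp, rfl⟩
      exact hc.1 ⟨p, hp.trans (le_iff_D.2 fun w y hy => (hj w y).2 (Or.inr hy)), rfl⟩
  · intro d hd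
    refine hc.2 ?_
    rintro _ ⟨p, hp, rfl⟩
    rcases eq_zero_or_eq_strElt p with rfl | ⟨x, y, rfl⟩
    · rw [map_zero]
      exact zero_le' _
    · rcases (hj _ _).1 (inclusion_strElt_le_iff.1 hp) with h | h
      · exact (ha.1 ⟨_, inclusion_strElt_le_iff.2 h, rfl⟩).trans (hd (by simp))
      · exact (hb.1 ⟨_, inclusion_strElt_le_iff.2 h, rfl⟩).trans (hd (by simp))

theorem exists_extension [NeZero n] (hB : IsDistributive B) {θ : P n →*₀ B}
    (hθ : IsLUB (Set.range fun i : Fin n => θ (gen i * (gen i)⁻¹)) 1) :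
    ∃ ψ : C n →*₀ B, IsJoinMorphism ψ ∧ ∀ s, ψ (ι n s) = θ s := by
  choose f hf using exists_isDistribLUB_imagesBelow hB θ
  have hlift : ∀ s t : D n, lenzHom (D n) s = lenzHom (D n) t → f s = f t := by
    intro s t h
    rw [lenzHom_eq_iff] at h
    have : upperBounds (imagesBelow θ s) = upperBounds (imagesBelow θ t) :=
      (upperBounds_imagesBelow_of_lenzLE hB hθ h.2).antisymm
        (upperBounds_imagesBelow_of_lenzLE hB hθ h.1)
    have hs := (hf s).1
    rw [IsLUB, this] at hs
    exact IsLeast.unique hs (hf t).1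
  -- The map on `C n` is defined through chosen representatives; `hgf` records that the choice is
  -- immaterial.
  choose g hg using lenzHom_surjective (S := D n)
  have hgf : ∀ s, f (g (lenzHom (D n) s)) = f s := fun s => hlift _ _ (hg _)
  have hι : ∀ p, f (g (ι n p)) = θ p := fun p =>
    (hgf _).trans ((hf _).1.unique (isLUB_imagesBelow_inclusion θ p))
  let ψ : C n →*₀ B :=
    { toFun := fun c => f (g c)
      map_zero' := by
        rw [← map_zero (ι n), hι, map_zero]
      map_one' := by
        rw [← map_one (ι n), hι, map_one]
      map_mul' := fun a b => by
        obtain ⟨s, rfl⟩ := lenzHom_surjective a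
        obtain ⟨t, rfl⟩ := lenzHom_surjective b
        rw [← map_mul, hgf, hgf, hgf]
        exact (hf _).1.unique (isLUB_imagesBelow_mul (hf s) (hf t)) }
  refine ⟨ψ, fun a b j h hj => ?_, hι⟩
  obtain ⟨s, rfl⟩ := lenzHom_surjective a
  obtain ⟨t, rfl⟩ := lenzHom_surjective b
  obtain ⟨k, hk⟩ := exists_union (compatible_of_lenz h)
  rw [hj.unique (isLUB_of_mem_or hk)]
  change IsLUB {f (g _), f (g _)} (f (g _))
  rw [hgf, hgf, hgf]
  exact isLUB_imagesBelow_union hk (hf s).1 (hf t).1 (hf k).1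

/-- Exhibits every class as a join of elements of `ι n`, over a finite set when the generating set
is finite; this forces uniqueness of the extension. -/
theorem isLUB_ι_piecesOver (s : D n) {X : Set (Str n)} (hX : domain s.1 = rightIdeal X) :
    IsLUB (ι n '' piecesOver s X) (lenzHom (D n) s) := by
  constructor
  · rintro _ ⟨p, hp, rfl⟩
    exact map_le_map (lenzHom (D n)) (inclusion_le_of_mem_piecesOver hp)
  · intro c hc
    obtain ⟨t, rfl⟩ := lenzHom_surjective c
    refine lenzHom_le_iff.2 fun x hx hxs => ?_
    obtain ⟨w, y, hy⟩ := exists_mem_of_ne_zero (pos_iff.1 hx)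
    have hpx := inclusion_strElt_le_iff.2 hy
    have hp : strElt y w ≠ 0 := fun h => inclusion_strElt_ne_zero y w (by rw [h, map_zero])
    obtain ⟨q, hq, hpq⟩ := exists_le_of_inclusion_le hX (hpx.trans hxs) hp
    have hqt : LenzLE (inclusion n q) t := lenzHom_le_iff.1 (hc ⟨q, hq, rfl⟩)
    obtain ⟨z, hz, hzp, hzt⟩ := hqt _ (pos_iff.2 (inclusion_strElt_ne_zero y w))
      (map_le_map _ hpq)
    exact ⟨z, hz, hzp.trans hpx, hzt⟩

theorem extension_unique [NeZero n] {ψ φ : C n →*₀ B} (hψ : IsJoinMorphism ψ)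
    (hφ : IsJoinMorphism φ) (h : ∀ s, ψ (ι n s) = φ (ι n s)) : ψ = φ := by
  ext c
  obtain ⟨s, rfl⟩ := lenzHom_surjective c
  obtain ⟨-, ⟨X, hX, hd⟩, -⟩ := s.2
  have hj := isLUB_ι_piecesOver s hd
  have hfin := (finite_piecesOver s hX).image (ι n)
  have h1 := hψ.map_isLUB isDistributive_C hfin hj
  have h2 := hφ.map_isLUB isDistributive_C hfin hj
  rw [← Set.image_comp] at h1 h2
  rw [show ψ ∘ ι n = φ ∘ ι n from funext h] at h1
  exact h1.unique h2

theorem existsUnique_extension [NeZero n] (hB : IsDistributive B) {θ : P n →*₀ B}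
    (hθ : IsLUB (Set.range fun i : Fin n => θ (gen i * (gen i)⁻¹)) 1) :
    ∃! ψ : C n →*₀ B, IsJoinMorphism ψ ∧ ∀ s, ψ (ι n s) = θ s := by
  obtain ⟨ψ, hψ, hψθ⟩ := exists_extension hB hθ
  exact ⟨ψ, ⟨hψ, hψθ⟩, fun φ hφ => extension_unique hφ.1 hψ fun s =>
    (hφ.2 s).trans (hψθ s).symm⟩

theorem isCoverToJoin_of_isLUB_gen [NeZero n] (hB : IsDistributive B) {θ : P n →*₀ B}
    (hθ : IsLUB (Set.range fun i : Fin n => θ (gen i * (gen i)⁻¹)) 1) : IsCoverToJoin θ := by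
  obtain ⟨ψ, hψ, hψθ⟩ := exists_extension hB hθ
  have h := hψ.isCoverToJoin_comp isDistributive_C isCoverToJoin_ι
  rwa [show ψ.comp (ι n) = θ from MonoidWithZeroHom.ext hψθ] at h

theorem isLUB_gen_of_isCoverToJoin [NeZero n] {θ : P n →*₀ B} (hθ : IsCoverToJoin θ) :
    IsLUB (Set.range fun i : Fin n => θ (gen i * (gen i)⁻¹)) 1 := by
  have h := hθ _ _ isTightCover_gen
  rwa [← Set.range_comp, map_one] at h

end PolycyclicCuntz

theorem mainTheorem2 (n : ℕ) (hn : 2 ≤ n) :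
    (∀ (B : Type u) [InverseMonoidWithZero B], InverseMonoidWithZero.IsBoolean B →
      ∀ θ : PolycyclicCuntz.P n →*₀ B,
        IsLUB (Set.range fun i : Fin n =>
          θ (PolycyclicCuntz.gen i * (PolycyclicCuntz.gen i)⁻¹)) 1 →
        InverseMonoidWithZero.IsCoverToJoin θ ∧
        ∃! ψ : PolycyclicCuntz.C n →*₀ B,
          InverseMonoidWithZero.IsJoinMorphism ψ ∧
            ∀ s, ψ (PolycyclicCuntz.ι n s) = θ s) ∧
    InverseMonoidWithZero.IsTightCompletion.{u, 0, 0} (PolycyclicCuntz.ι n) := by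
  have : NeZero n := ⟨by omega⟩
  refine ⟨fun B _ hB θ hθ => ⟨PolycyclicCuntz.isCoverToJoin_of_isLUB_gen hB.1 hθ,
    PolycyclicCuntz.existsUnique_extension hB.1 hθ⟩, PolycyclicCuntz.isBoolean_C,
    PolycyclicCuntz.isCoverToJoin_ι, fun B _ hB θ hθ => ?_⟩
  exact PolycyclicCuntz.existsUnique_extension hB.1
    (PolycyclicCuntz.isLUB_gen_of_isCoverToJoin hθ)
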